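/- Let $F$ be a field of characteristic different from $2$ and $3$. A Kantor triple system over $F$ is a vector space $U$ (of any dimension) with a trilinear product $xyz$ such that, with $L(x,y)z=xyz$ and $K(x,y)z=xzy-yzx$, $$[L(u,v),L(x,y)]=L(uvx,y)-L(x,vuy),\qquad K(K(u,v)x,y)=K(u,v)L(x,y)+L(y,x)K(u,v)$$ for all $u,v,x,y\in U$; it is left unital if $L(e,e)=\mathrm{id}$ for some $e\in U$. The Lie algebra $\mathfrak g(U)=\mathcal L\oplus\mathcal T$ of $U$ is defined as follows: $\mathcal T$ is the space of columns $\begin{pmatrix}a\\b\end{pmatrix}$ with $a,b\in U$, and $\mathcal L\subseteq \mathrm{Mat}_2(\mathrm{End}_F(U))$ is the span of all matrices $\begin{pmatrix}L(a,b)&K(c,d)\\K(e,f)&-L(b,a)\end{pmatrix}$. The bracket on $\mathcal L$ is the commutator, $[M,X]=M(X)$ for $M\in\mathcal L$, $X\in\mathcal T$, and $$\left[\begin{pmatrix}a_1\\b_1\end{pmatrix},\begin{pmatrix}a_2\\b_2\end{pmatrix}\right]=\begin{pmatrix}L(a_1,b_2)-L(a_2,b_1)&K(a_1,a_2)\\K(b_1,b_2)&-L(b_2,a_1)+L(b_1,a_2)\end{pmatrix}.$$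 It is $5$-graded: $\mathfrak g(U)_{1}$ and $\mathfrak g(U)_{-1}$ consist of the columns with second, respectively first, entry zero; $\mathfrak g(U)_0$ is spanned by the matrices $\begin{pmatrix}L(a,b)&0\\0&-L(b,a)\end{pmatrix}$; and $\mathfrak g(U)_{2}$ and $\mathfrak g(U)_{-2}$ are spanned by the matrices $\begin{pmatrix}0&K(a,b)\\0&0\end{pmatrix}$ and $\begin{pmatrix}0&0\\K(a,b)&0\end{pmatrix}$, respectively. A structurable algebra over $F$ is a unital, not necessarily associative, $F$-algebra $A$ with an involution $x\mapsto\bar x$ (an $F$-linear anti-automorphism with $\bar{\bar x}=x$) such that, with $(x,y,z)=(xy)z-x(yz)$ and $V_{x,y}z=(x\bar y)z+(z\bar y)x-(z\bar x)y$, $$(x-\bar x,y,z)=(y,\bar x-x,z),\qquad [V_{u,v},V_{x,y}]=V_{V_{u,v}x,y}-V_{x,V_{v,u}y}.$$ Let $S=\{s\in A:\bar s=-s\}$ and $\mathrm{Instrl}(A)=\mathrm{span}\{V_{x,y}:x,y\in A\}$, put $\psi(x,y)=x\bar y-y\bar x$, let $L_r$ denote left multiplication by $r$, and for $T\in\mathrm{Instrl}(A)$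 put $T^\varepsilon=T-L_{T(1)+\overline{T(1)}}$ and $T^\delta(s)=T(s)+s\,\overline{T(1)}$ for $s\in S$. Allison's algebra is $\mathcal K(A)=\widetilde N\oplus \mathrm{Instrl}(A)\oplus N$, where $N=A\times S$ and $\widetilde N$ is a copy of $N$, with the commutator bracket on $\mathrm{Instrl}(A)$ and $$[T,(x,s)]=(Tx,T^\delta s),\qquad [T,(y,t)^\sim]=(T^\varepsilon y,(T^\varepsilon)^\delta t)^\sim,$$ $$[(x,s),(x',s')]=(0,\psi(x,x')),\qquad [(y,t)^\sim,(y',t')^\sim]=(0,\psi(y,y'))^\sim,$$ $$[(x,s),(y,t)^\sim]=-(tx,0)^\sim+V_{x,y}+L_sL_t+(sy,0).$$ It is $5$-graded with components $(0,S)^\sim,\ (A,0)^\sim,\ \mathrm{Instrl}(A),\ (A,0),\ (0,S)$ in degrees $-2,-1,0,1,2$. A Lie algebra $\mathcal G$ over $F$ is graded over the nonreduced root system $BC_1=\{\pm\alpha,\pm2\alpha\}$ and of type $B_1$ if it contains a subalgebra isomorphic to $\mathfrak{sl}_2(F)$, with root system $\{\pm\alpha\}$ relative to the split Cartan subalgebra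 $Fh$, where $h$ corresponds to $\mathrm{diag}(1,-1)$ and $\alpha(h)=2$, such that $\mathcal G=\bigoplus_{\mu\in BC_1\cup\{0\}}\mathcal G_\mu$ with $\mathcal G_\mu=\{x\in\mathcal G:[h,x]=\mu(h)x\}$, and $\mathcal G_0=\sum_{\mu\in BC_1}[\mathcal G_\mu,\mathcal G_{-\mu}]$. **Corollary.** Let $U$ be a left unital Kantor triple system over $F$. Then there are a structurable algebra $A$ over $F$ and an isomorphism of Lie algebras $\mathfrak g(U)\to\mathcal K(A)$ that maps $\mathfrak g(U)_i$ onto $\mathcal K(A)_i$ for every $i$. Moreover, if $U\neq0$, then $\mathfrak g(U)$ is graded over the nonreduced root system $BC_1$ and of type $B_1$. -/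

import Mathlib

set_option linter.unusedSectionVars false
set_option linter.unusedSimpArgs false

/-- A Kantor triple system over `F` on the vector space `U`: a trilinear product `x y z` (written
`triple x y z`), so that `triple x y` is the operator `L(x,y) : z ↦ xyz`, subject to
`[L(u,v),L(x,y)] = L(uvx,y) - L(x,vuy)` and `K(K(u,v)x,y) = K(u,v)L(x,y) + L(y,x)K(u,v)`, where
`K(x,y) : z ↦ xzy - yzx`. -/
structure KantorTripleSystem (F U : Type*) [Field F] [AddCommGroup U] [Module F U] where
  /-- The trilinear product. -/
  triple : U →ₗ[F] U →ₗ[F] U →ₗ[F] U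
  /-- `[L(u,v),L(x,y)] = L(uvx,y) - L(x,vuy)`, evaluated at `z`. -/
  triple_triple : ∀ u v x y z,
    triple u v (triple x y z) - triple x y (triple u v z) =
      triple (triple u v x) y z - triple x (triple v u y) z
  /-- `K(K(u,v)x,y) = K(u,v)L(x,y) + L(y,x)K(u,v)`, evaluated at `z`. -/
  kantor : ∀ u v x y z,
    triple (triple u x v - triple v x u) z y - triple y z (triple u x v - triple v x u) =
      (triple u (triple x y z) v - triple v (triple x y z) u) +
        triple y x (triple u z v - triple v z u)

namespace KantorTripleSystem

attribute [local instance] LieRing.ofAssociativeRing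

variable {F U : Type*} [Field F] [AddCommGroup U] [Module F U] (T : KantorTripleSystem F U)

/-- The operator `L(x,y) : z ↦ xyz`. -/
def L (x y : U) : Module.End F U := T.triple x y

/-- The operator `K(x,y) : z ↦ xzy - yzx`. -/
def K (x y : U) : Module.End F U := (T.triple x).flip y - (T.triple y).flip x

/-- `e` is a left unit: `L(e,e) = id`. -/
def IsLeftUnit (e : U) : Prop := T.L e e = LinearMap.id

/-- The triple system has a left unit. -/
def IsLeftUnital : Prop := ∃ e : U, T.IsLeftUnit e

@[simp] theorem L_apply (x y z : U) : T.L x y z = T.triple x y z := rfl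

@[simp] theorem K_apply (x y z : U) : T.K x y z = T.triple x z y - T.triple y z x := rfl

/-- For columns `X = (a₁,b₁)` and `Y = (a₂,b₂)` over `U`, the matrix of operators
`[L(a₁,b₂) - L(a₂,b₁), K(a₁,a₂); K(b₁,b₂), -L(b₂,a₁) + L(b₁,a₂)]`. -/
def colBracket (X Y : Fin 2 → U) : Matrix (Fin 2) (Fin 2) (Module.End F U) :=
  !![T.L (X 0) (Y 1) - T.L (Y 0) (X 1), T.K (X 0) (Y 0);
     T.K (X 1) (Y 1), -T.L (Y 1) (X 0) + T.L (X 1) (Y 0)]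

/-- A matrix of operators acting on columns. -/
def act (M : Matrix (Fin 2) (Fin 2) (Module.End F U)) (X : Fin 2 → U) : Fin 2 → U :=
  fun i => ∑ j, M i j (X j)

/-- The matrices `[L(a,b), K(c,d); K(e,f), -L(b,a)]`. -/
def genMatrix (a b c d e f : U) : Matrix (Fin 2) (Fin 2) (Module.End F U) :=
  !![T.L a b, T.K c d; T.K e f, -T.L b a]

/-- The linear span of all the matrices `[L(a,b), K(c,d); K(e,f), -L(b,a)]`. -/
def evenSpan : Submodule F (Matrix (Fin 2) (Fin 2) (Module.End F U)) :=
  Submodule.span F {M | ∃ a b c d e f : U, M = T.genMatrix a b c d e f}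

theorem act_add (M : Matrix (Fin 2) (Fin 2) (Module.End F U)) (X Y : Fin 2 → U) :
    act M (X + Y) = act M X + act M Y := by
  ext i; simp [act, Finset.sum_add_distrib]

theorem act_smul (M : Matrix (Fin 2) (Fin 2) (Module.End F U)) (c : F) (X : Fin 2 → U) :
    act M (c • X) = c • act M X := by
  ext i; simp [act]

theorem add_act (M N : Matrix (Fin 2) (Fin 2) (Module.End F U)) (X : Fin 2 → U) :
    act (M + N) X = act M X + act N X := by
  ext i; simp [act, Finset.sum_add_distrib]

theorem smul_act (M : Matrix (Fin 2) (Fin 2) (Module.End F U)) (c : F) (X : Fin 2 → U) :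
    act (c • M) X = c • act M X := by
  ext i; simp [act]

theorem zero_act (X : Fin 2 → U) :
    act (0 : Matrix (Fin 2) (Fin 2) (Module.End F U)) X = 0 := by
  ext i; simp [act]

theorem lie_act (M N : Matrix (Fin 2) (Fin 2) (Module.End F U)) (X : Fin 2 → U) :
    act ⁅M, N⁆ X = act M (act N X) - act N (act M X) := by
  ext i; simp [act, Ring.lie_def, Matrix.mul_apply]; abel

theorem L_add (x y z : U) : T.L (x + y) z = T.L x z + T.L y z := by ext; simp
theorem L_add' (x y z : U) : T.L x (y + z) = T.L x y + T.L x z := by ext; simp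
theorem L_smul (c : F) (x z : U) : T.L (c • x) z = c • T.L x z := by ext; simp
theorem L_smul' (c : F) (x z : U) : T.L x (c • z) = c • T.L x z := by ext; simp
theorem K_add (x y z : U) : T.K (x + y) z = T.K x z + T.K y z := by ext; simp; abel
theorem K_add' (x y z : U) : T.K x (y + z) = T.K x y + T.K x z := by ext; simp; abel
theorem K_smul (c : F) (x z : U) : T.K (c • x) z = c • T.K x z := by ext; simp [smul_sub]
theorem K_smul' (c : F) (x z : U) : T.K x (c • z) = c • T.K x z := by ext; simp [smul_sub]

theorem colBracket_add (X Y Z : Fin 2 → U) :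
    T.colBracket (X + Y) Z = T.colBracket X Z + T.colBracket Y Z := by
  ext i j : 2
  fin_cases i <;> fin_cases j <;> simp [colBracket, L_add, L_add', K_add] <;> abel

theorem colBracket_smul (c : F) (X Y : Fin 2 → U) :
    T.colBracket (c • X) Y = c • T.colBracket X Y := by
  ext i j : 2
  fin_cases i <;> fin_cases j <;> simp [colBracket, L_smul, L_smul', K_smul, smul_sub]

theorem colBracket_swap (X Y : Fin 2 → U) : T.colBracket Y X = -T.colBracket X Y := by
  ext i j u
  fin_cases i <;> fin_cases j <;> simp [colBracket] <;> abel

theorem colBracket_self (X : Fin 2 → U) : T.colBracket X X = 0 := by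
  ext i j u
  fin_cases i <;> fin_cases j <;> simp [colBracket]

theorem colBracket_add' (X Y Z : Fin 2 → U) :
    T.colBracket X (Y + Z) = T.colBracket X Y + T.colBracket X Z := by
  rw [colBracket_swap, colBracket_add, T.colBracket_swap X Y, T.colBracket_swap X Z]; abel

theorem colBracket_smul' (c : F) (X Y : Fin 2 → U) :
    T.colBracket X (c • Y) = c • T.colBracket X Y := by
  rw [colBracket_swap, colBracket_smul, T.colBracket_swap X Y]; simp

theorem cyclic (X Y Z : Fin 2 → U) :
    act (T.colBracket X Y) Z + act (T.colBracket Y Z) X + act (T.colBracket Z X) Y = 0 := by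
  ext i
  fin_cases i <;> simp [act, colBracket] <;> abel

theorem genMatrix_eq (a b c d e f : U) : T.genMatrix a b c d e f =
    T.colBracket ![a, 0] ![0, b] + T.colBracket ![c, 0] ![d, 0] +
      T.colBracket ![0, e] ![0, f] := by
  ext i j u
  fin_cases i <;> fin_cases j <;> simp [colBracket, genMatrix]

theorem colBracket_mem (X Y : Fin 2 → U) : T.colBracket X Y ∈ T.evenSpan := by
  have h : T.colBracket X Y = T.genMatrix (X 0) (Y 1) (X 0) (Y 0) (X 1) (Y 1) -
      T.genMatrix (Y 0) (X 1) 0 0 0 0 := by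
    ext i j u
    fin_cases i <;> fin_cases j <;> simp [colBracket, genMatrix]
  rw [h]
  exact T.evenSpan.sub_mem (Submodule.subset_span ⟨_, _, _, _, _, _, rfl⟩)
    (Submodule.subset_span ⟨_, _, _, _, _, _, rfl⟩)

theorem lie_colBracket_gen (a b c d e f : U) (X Y : Fin 2 → U) :
    ⁅T.genMatrix a b c d e f, T.colBracket X Y⁆ =
      T.colBracket (act (T.genMatrix a b c d e f) X) Y +
        T.colBracket X (act (T.genMatrix a b c d e f) Y) := by
  ext i j z
  have g := T.triple_triple
  have k := T.kantor
  simp only [map_sub, LinearMap.sub_apply] at g k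
  fin_cases i <;> fin_cases j <;>
    simp [colBracket, genMatrix, act, LieRing.of_associative_ring_bracket]
  · linear_combination (norm := ((try simp only [map_sub, map_neg, map_add]); abel))
      g a b (X 0) (Y 1) z - g a b (Y 0) (X 1) z - k c d (X 1) z (Y 1) + k c d (Y 1) z (X 1)
      + k (X 0) (Y 0) e z f - k (X 0) (Y 0) f z e + g (X 0) e (Y 0) f z + g (Y 0) f (X 0) e z
      - g (Y 0) e (X 0) f z - g (X 0) f (Y 0) e z
  · linear_combination (norm := ((try simp only [map_sub, map_neg, map_add]); abel))
      g a b (X 0) z (Y 0) - g a b (Y 0) z (X 0) - k c d (X 1) (Y 0) z + k c d (Y 1) (X 0) z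
  · linear_combination (norm := ((try simp only [map_sub, map_neg, map_add]); abel))
      g b a (Y 1) z (X 1) - g b a (X 1) z (Y 1) - k e f (X 0) (Y 1) z + k e f (Y 0) (X 1) z
  · linear_combination (norm := ((try simp only [map_sub, map_neg, map_add]); abel))
      g b a (Y 1) (X 0) z - g b a (X 1) (Y 0) z - k e f (X 0) z (Y 0) + k e f (Y 0) z (X 0)
      + k (X 1) (Y 1) c z d - k (X 1) (Y 1) d z c + g (X 1) c (Y 1) d z + g (Y 1) d (X 1) c z
      - g (Y 1) c (X 1) d z - g (X 1) d (Y 1) c z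

theorem lie_colBracket {M : Matrix (Fin 2) (Fin 2) (Module.End F U)} (hM : M ∈ T.evenSpan)
    (X Y : Fin 2 → U) :
    ⁅M, T.colBracket X Y⁆ = T.colBracket (act M X) Y + T.colBracket X (act M Y) := by
  induction hM using Submodule.span_induction with
  | mem M h =>
    obtain ⟨a, b, c, d, e, f, rfl⟩ := h
    exact T.lie_colBracket_gen a b c d e f X Y
  | zero =>
    simp only [zero_act, zero_lie]
    rw [← zero_smul F (0 : Fin 2 → U), colBracket_smul, colBracket_smul']; simp
  | add M N _ _ hM hN => rw [add_lie, hM, hN, add_act, add_act, colBracket_add, colBracket_add']; abel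
  | smul c M _ hM =>
    rw [smul_lie, hM, smul_act, smul_act, colBracket_smul, colBracket_smul', smul_add]

/-- The Lie algebra `𝓛` of matrices of operators spanned by all
`[L(a,b), K(c,d); K(e,f), -L(b,a)]`, with the commutator bracket. -/
def even : LieSubalgebra F (Matrix (Fin 2) (Fin 2) (Module.End F U)) where
  __ := T.evenSpan
  lie_mem' := by
    intro M N hM hN
    change M ∈ T.evenSpan at hM
    change N ∈ T.evenSpan at hN
    change ⁅M, N⁆ ∈ T.evenSpan
    induction hN using Submodule.span_induction with
    | mem N h =>
      obtain ⟨a, b, c, d, e, f, rfl⟩ := h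
      rw [genMatrix_eq, lie_add, lie_add, T.lie_colBracket hM, T.lie_colBracket hM,
        T.lie_colBracket hM]
      have := T.colBracket_mem
      exact add_mem (add_mem (add_mem (this _ _) (this _ _)) (add_mem (this _ _) (this _ _)))
        (add_mem (this _ _) (this _ _))
    | zero => rw [lie_zero]; exact zero_mem _
    | add x y _ _ hx hy => rw [lie_add]; exact add_mem hx hy
    | smul c x _ hx => rw [lie_smul]; exact Submodule.smul_mem _ _ hx

/-- The column bracket, as an element of `𝓛`. -/
def colLie (X Y : Fin 2 → U) : T.even := ⟨T.colBracket X Y, T.colBracket_mem X Y⟩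

/-- The vector space `𝔤(U) = 𝓛 ⊕ 𝓣`, where `𝓣` is the space of columns of length two over `U`. -/
def LieAlg : Type _ := T.even × (Fin 2 → U)

noncomputable instance : AddCommGroup T.LieAlg :=
  inferInstanceAs (AddCommGroup (T.even × (Fin 2 → U)))

noncomputable instance : Module F T.LieAlg :=
  inferInstanceAs (Module F (T.even × (Fin 2 → U)))

/-- The component of an element of `𝔤(U)` in `𝓛`, as a matrix of operators. -/
def LieAlg.mat {T : KantorTripleSystem F U} (P : T.LieAlg) :
    Matrix (Fin 2) (Fin 2) (Module.End F U) := P.1.1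

/-- The component of an element of `𝔤(U)` in the space of columns. -/
def LieAlg.col {T : KantorTripleSystem F U} (P : T.LieAlg) : Fin 2 → U := P.2

/-- The bracket of `𝔤(U)`: the commutator on `𝓛`, the action `[M,X] = M X` of `𝓛` on columns, and
`[X,Y]` the column bracket for columns `X`, `Y`. -/
noncomputable instance : Bracket T.LieAlg T.LieAlg where
  bracket P Q := (⁅P.1, Q.1⁆ + T.colLie P.col Q.col, act P.mat Q.col - act Q.mat P.col)

@[ext] theorem LieAlg.ext {P Q : T.LieAlg} (h1 : P.mat = Q.mat) (h2 : P.col = Q.col) : P = Q :=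
  Prod.ext (Subtype.ext h1) h2

theorem mat_lie (P Q : T.LieAlg) :
    (⁅P, Q⁆ : T.LieAlg).mat = ⁅P.mat, Q.mat⁆ + T.colBracket P.col Q.col := rfl
theorem col_lie (P Q : T.LieAlg) :
    (⁅P, Q⁆ : T.LieAlg).col = act P.mat Q.col - act Q.mat P.col := rfl
theorem mat_zero : (0 : T.LieAlg).mat = 0 := rfl
theorem col_zero : (0 : T.LieAlg).col = 0 := rfl
theorem mat_add (P Q : T.LieAlg) : (P + Q).mat = P.mat + Q.mat := rfl
theorem col_add (P Q : T.LieAlg) : (P + Q).col = P.col + Q.col := rfl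
theorem mat_smul (c : F) (P : T.LieAlg) : (c • P).mat = c • P.mat := rfl
theorem col_smul (c : F) (P : T.LieAlg) : (c • P).col = c • P.col := rfl

theorem act_sub (M : Matrix (Fin 2) (Fin 2) (Module.End F U)) (X Y : Fin 2 → U) :
    act M (X - Y) = act M X - act M Y := by
  ext i; simp [act]

theorem colBracket_sub (X Y Z : Fin 2 → U) :
    T.colBracket (X - Y) Z = T.colBracket X Z - T.colBracket Y Z := by
  rw [eq_sub_iff_add_eq, ← colBracket_add, sub_add_cancel]

theorem colBracket_sub' (X Y Z : Fin 2 → U) :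
    T.colBracket X (Y - Z) = T.colBracket X Y - T.colBracket X Z := by
  rw [eq_sub_iff_add_eq, ← colBracket_add', sub_add_cancel]

theorem mat_colBracket (P : T.LieAlg) (X Y : Fin 2 → U) :
    ⁅P.mat, T.colBracket X Y⁆ =
      T.colBracket (act P.mat X) Y + T.colBracket X (act P.mat Y) :=
  T.lie_colBracket P.1.2 X Y

noncomputable instance : LieRing T.LieAlg where
  add_lie P Q R := by
    ext : 1
    · simp only [mat_lie, mat_add, col_add, add_lie, colBracket_add]; abel
    · simp only [col_lie, mat_add, col_add, add_act, act_add]; abel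
  lie_add P Q R := by
    ext : 1
    · simp only [mat_lie, mat_add, col_add, lie_add, colBracket_add']; abel
    · simp only [col_lie, mat_add, col_add, add_act, act_add]; abel
  lie_self P := by
    ext : 1
    · rw [mat_lie, lie_self, colBracket_self, add_zero, mat_zero]
    · rw [col_lie, sub_self, col_zero]
  leibniz_lie P Q R := by
    ext : 1
    · simp only [mat_lie, col_lie, mat_add, lie_add, add_lie, mat_colBracket,
        colBracket_sub, colBracket_sub']
      rw [leibniz_lie, ← lie_skew (T.colBracket P.col Q.col) R.mat, mat_colBracket,
        T.colBracket_swap (act R.mat P.col) Q.col]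
      abel
    · have h := T.cyclic P.col Q.col R.col
      rw [T.colBracket_swap P.col R.col, ← neg_one_smul F (T.colBracket P.col R.col), smul_act,
        neg_one_smul] at h
      simp only [mat_lie, col_lie, col_add, add_act, lie_act, act_sub]
      linear_combination (norm := abel) -h

noncomputable instance : LieAlgebra F T.LieAlg where
  lie_smul c P Q := by
    ext : 1
    · simp only [mat_lie, mat_smul, col_smul, lie_smul, colBracket_smul', smul_add]
    · simp only [col_lie, mat_smul, col_smul, act_smul, smul_act, smul_sub]

/-- The elements of `𝔤(U)` whose matrix lies in `N` and whose column lies in `W`. -/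
noncomputable def component (N : Submodule F (Matrix (Fin 2) (Fin 2) (Module.End F U)))
    (W : Submodule F (Fin 2 → U)) : Submodule F T.LieAlg where
  carrier := {P | P.mat ∈ N ∧ P.col ∈ W}
  add_mem' h h' := ⟨N.add_mem h.1 h'.1, W.add_mem h.2 h'.2⟩
  zero_mem' := ⟨N.zero_mem, W.zero_mem⟩
  smul_mem' c _ h := ⟨N.smul_mem c h.1, W.smul_mem c h.2⟩

/-- The homogeneous components of the `5`-grading of `𝔤(U)`; the components of degree outside
`{-2,-1,0,1,2}` are zero. -/
noncomputable def grading (i : ℤ) : Submodule F T.LieAlg :=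
  if i = 0 then T.component (Submodule.span F {M | ∃ a b, M = !![T.L a b, 0; 0, -T.L b a]}) ⊥
  else if i = 1 then T.component ⊥ (LinearMap.ker (LinearMap.proj 1))
  else if i = -1 then T.component ⊥ (LinearMap.ker (LinearMap.proj 0))
  else if i = 2 then T.component (Submodule.span F {M | ∃ a b, M = !![0, T.K a b; 0, 0]}) ⊥
  else if i = -2 then T.component (Submodule.span F {M | ∃ a b, M = !![0, 0; T.K a b, 0]}) ⊥
  else ⊥

end KantorTripleSystem

section Structurable

variable (F : Type*) {A : Type*} [Field F] [NonAssocRing A] [StarRing A] [Module F A]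
  [SMulCommClass F A A] [IsScalarTower F A A]

/-- The operator `V_{x,y}(z) = (x ȳ) z + (z ȳ) x - (z x̄) y`. -/
def opV (x y : A) : Module.End F A :=
  LinearMap.mulLeft F (x * star y) + LinearMap.mulRight F x * LinearMap.mulRight F (star y) -
    LinearMap.mulRight F y * LinearMap.mulRight F (star x)

@[simp] theorem opV_apply (x y z : A) :
    opV F x y z = (x * star y) * z + (z * star y) * x - (z * star x) * y := rfl

variable (A) in
/-- A structurable algebra over `F`: a unital, not necessarily associative, `F`-algebra `A` with an
involution `x ↦ star x` (an `F`-linear anti-automorphism of period two), such that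
`(x - x̄, y, z) = (y, x̄ - x, z)` and `[V_{u,v},V_{x,y}] = V_{V_{u,v}x,y} - V_{x,V_{v,u}y}`. -/
class IsStructurable : Prop where
  star_smul : ∀ (c : F) (x : A), star (c • x) = c • star x
  associator_sub_star : ∀ x y z : A,
    associator (x - star x) y z = associator y (star x - x) z
  opV_comm : ∀ u v x y : A, opV F u v * opV F x y - opV F x y * opV F u v =
    opV F (opV F u v x) y - opV F x (opV F v u y)

variable (A) in
/-- The subspace `S` of skew-symmetric elements. -/
def skewPart [IsStructurable F A] : Submodule F A where
  carrier := {s | star s = -s}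
  add_mem' {a b} ha hb := by
    simp only [Set.mem_ofPred_eq] at *
    rw [star_add, ha, hb]; abel
  zero_mem' := by simp
  smul_mem' c x hx := by
    simp only [Set.mem_ofPred_eq] at *
    rw [IsStructurable.star_smul, hx, smul_neg]

namespace Structurable

variable {F}
variable [IsStructurable F A]

theorem star_skew (s : skewPart F A) : star (s : A) = -s := s.2

theorem star_assoc (x y z : A) :
    star (associator x y z) = -associator (star z) (star y) (star x) := by
  simp [associator]

theorem cancel_two [NeZero (2 : F)] {x y : A} (h : x + x = y + y) : x = y := by
  have h2 : (2 : F) • x = (2 : F) • y := by rw [two_smul, two_smul, h]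
  exact smul_right_injective A (NeZero.ne (2 : F)) h2

theorem assoc_skew [NeZero (2 : F)] (s : skewPart F A) (y z : A) :
    associator (s : A) y z = -associator y (s : A) z := by
  have h := IsStructurable.associator_sub_star (F := F) (s : A) y z
  rw [star_skew] at h
  refine cancel_two (F := F) ?_
  simp only [associator, sub_neg_eq_add, add_mul, mul_add, mul_sub, sub_mul, mul_neg, neg_mul] at h ⊢
  linear_combination (norm := abel) h

theorem assoc_skew_right [NeZero (2 : F)] (t : skewPart F A) (x y : A) :
    associator x y (t : A) = -associator x (t : A) y := by
  have h := congrArg star (assoc_skew t (star y) (star x))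
  rw [star_neg, star_assoc, star_assoc, star_star, star_star, star_skew] at h
  simp only [associator, mul_neg, neg_mul] at h ⊢
  linear_combination (norm := abel) h

/-- The element `ψ(x,y) = x ȳ - y x̄` of the space of skew-symmetric elements. -/
def psi (x y : A) : skewPart F A :=
  ⟨x * star y - y * star x, by
    change star _ = -_
    simp⟩

/-- `T^ε = T - L_{T(1) + conj(T(1))}`, as an operator on `A`. -/
def epsEnd (T : Module.End F A) : Module.End F A :=
  T - LinearMap.mulLeft F (T 1 + star (T 1))

theorem epsEnd_apply (T : Module.End F A) (x : A) :
    epsEnd T x = T x - (T 1 + star (T 1)) * x := rfl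

theorem epsEnd_zero : epsEnd (0 : Module.End F A) = 0 := by
  ext x; simp [epsEnd_apply]

theorem epsEnd_add (S T : Module.End F A) : epsEnd (S + T) = epsEnd S + epsEnd T := by
  ext x
  simp only [epsEnd_apply, LinearMap.add_apply, star_add, add_mul]; abel

theorem epsEnd_smul (c : F) (T : Module.End F A) : epsEnd (c • T) = c • epsEnd T := by
  ext x
  simp only [epsEnd_apply, LinearMap.smul_apply, IsStructurable.star_smul, ← smul_add,
    smul_mul_assoc, smul_sub]

theorem epsEnd_opV (x y : A) : epsEnd (opV F x y) = -opV F y x := by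
  ext z
  simp [epsEnd_apply, add_mul, sub_mul]
  abel

theorem epsEnd_epsEnd (T : Module.End F A) : epsEnd (epsEnd T) = T := by
  ext z
  simp [epsEnd_apply, add_mul]
  abel

attribute [local instance] LieRing.ofAssociativeRing

variable (F A) in
/-- The inner structure algebra `Instrl(A)`: the span of the operators `V_{x,y}`, with the
commutator bracket. -/
def instrl : LieSubalgebra F (Module.End F A) where
  __ := Submodule.span F {T | ∃ x y : A, T = opV F x y}
  lie_mem' := by
    intro S T hS hT
    change S ∈ Submodule.span F {T | ∃ x y : A, T = opV F x y} at hS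
    change T ∈ Submodule.span F {T | ∃ x y : A, T = opV F x y} at hT
    change ⁅S, T⁆ ∈ Submodule.span F {T | ∃ x y : A, T = opV F x y}
    induction hS using Submodule.span_induction with
    | mem S h =>
      obtain ⟨u, v, rfl⟩ := h
      induction hT using Submodule.span_induction with
      | mem T h =>
        obtain ⟨x, y, rfl⟩ := h
        rw [LieRing.of_associative_ring_bracket, IsStructurable.opV_comm]
        exact sub_mem (Submodule.subset_span ⟨_, _, rfl⟩) (Submodule.subset_span ⟨_, _, rfl⟩)
      | zero => rw [lie_zero]; exact zero_mem _
      | add x y _ _ hx hy => rw [lie_add]; exact add_mem hx hy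
      | smul c x _ hx => rw [lie_smul]; exact Submodule.smul_mem _ _ hx
    | zero => rw [zero_lie]; exact zero_mem _
    | add x y _ _ hx hy => rw [add_lie]; exact add_mem hx hy
    | smul c x _ hx => rw [smul_lie]; exact Submodule.smul_mem _ _ hx

theorem opV_mem (x y : A) : opV F x y ∈ instrl F A := Submodule.subset_span ⟨x, y, rfl⟩

theorem instrl_induction {p : Module.End F A → Prop} (hV : ∀ x y, p (opV F x y)) (h0 : p 0)
    (hadd : ∀ S T, p S → p T → p (S + T)) (hsmul : ∀ (c : F) S, p S → p (c • S))
    {T : Module.End F A} (hT : T ∈ instrl F A) : p T := by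
  change T ∈ Submodule.span F {T | ∃ x y : A, T = opV F x y} at hT
  induction hT using Submodule.span_induction with
  | mem S h => obtain ⟨x, y, rfl⟩ := h; exact hV x y
  | zero => exact h0
  | add x y _ _ hx hy => exact hadd x y hx hy
  | smul c x _ hx => exact hsmul c x hx

theorem epsEnd_mem {T : Module.End F A} (hT : T ∈ instrl F A) : epsEnd T ∈ instrl F A := by
  refine instrl_induction (p := fun T => epsEnd T ∈ instrl F A) ?_ ?_ ?_ ?_ hT
  · intro x y; rw [epsEnd_opV]; exact neg_mem (opV_mem y x)
  · rw [epsEnd_zero]; exact zero_mem _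
  · intro S T hS hT; rw [epsEnd_add]; exact add_mem hS hT
  · intro c S hS; rw [epsEnd_smul]; exact SMulMemClass.smul_mem c hS

theorem opV_add (x y z : A) : opV F (x + y) z = opV F x z + opV F y z := by
  ext; simp [add_mul, mul_add]; abel
theorem opV_add' (x y z : A) : opV F x (y + z) = opV F x y + opV F x z := by
  ext; simp [add_mul, mul_add]; abel
theorem opV_smul (c : F) (x y : A) : opV F (c • x) y = c • opV F x y := by
  ext; simp [IsStructurable.star_smul, smul_mul_assoc, mul_smul_comm, smul_add, smul_sub]
theorem opV_smul' (c : F) (x y : A) : opV F x (c • y) = c • opV F x y := by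
  ext; simp [IsStructurable.star_smul, smul_mul_assoc, mul_smul_comm, smul_add, smul_sub]
theorem opV_sub (x y z : A) : opV F (x - y) z = opV F x z - opV F y z := by
  rw [eq_sub_iff_add_eq, ← opV_add, sub_add_cancel]
theorem opV_sub' (x y z : A) : opV F x (y - z) = opV F x y - opV F x z := by
  rw [eq_sub_iff_add_eq, ← opV_add', sub_add_cancel]
theorem opV_neg' (x y : A) : opV F x (-y) = -opV F x y := by
  rw [← neg_one_smul F y, opV_smul', neg_one_smul]

/-- Elements of `Instrl(A)` act as derivations of the triple product, up to `ε`. -/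
theorem instrl_opV {T : Module.End F A} (hT : T ∈ instrl F A) (x y : A) :
    T * opV F x y - opV F x y * T = opV F (T x) y + opV F x (epsEnd T y) := by
  refine instrl_induction (p := fun T => T * opV F x y - opV F x y * T =
    opV F (T x) y + opV F x (epsEnd T y)) ?_ ?_ ?_ ?_ hT
  · intro u v
    rw [IsStructurable.opV_comm, epsEnd_opV, LinearMap.neg_apply, opV_neg', sub_eq_add_neg]
  · rw [epsEnd_zero]
    have h1 : opV F (0 : A) y = 0 := by rw [← zero_smul F (0 : A), opV_smul, zero_smul]
    have h2 : opV F x (0 : A) = 0 := by rw [← zero_smul F (0 : A), opV_smul', zero_smul]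
    simp [h1, h2, -opV_apply]
  · intro S T hS hT
    rw [epsEnd_add, LinearMap.add_apply, LinearMap.add_apply, opV_add, opV_add', add_mul, mul_add]
    linear_combination (norm := abel) hS + hT
  · intro c S hS
    rw [epsEnd_smul, LinearMap.smul_apply, LinearMap.smul_apply, opV_smul, opV_smul', ← smul_add,
      ← hS, smul_sub, smul_mul_assoc, mul_smul_comm]

theorem epsEnd_lie {S T : Module.End F A} (hS : S ∈ instrl F A) (hT : T ∈ instrl F A) :
    epsEnd (S * T - T * S) = epsEnd S * epsEnd T - epsEnd T * epsEnd S := by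
  have hneg : ∀ S : Module.End F A, epsEnd (-S) = -epsEnd S := by
    intro S; rw [← neg_one_smul F S, epsEnd_smul, neg_one_smul]
  refine instrl_induction (p := fun T => epsEnd (S * T - T * S) =
    epsEnd S * epsEnd T - epsEnd T * epsEnd S) ?_ ?_ ?_ ?_ hT
  · intro x y
    have h := instrl_opV (epsEnd_mem hS) y x
    rw [epsEnd_epsEnd] at h
    rw [instrl_opV hS, epsEnd_add, epsEnd_opV, epsEnd_opV, epsEnd_opV, mul_neg, neg_mul]
    linear_combination (norm := abel) h
  · simp [epsEnd_zero]
  · intro T T' h h'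
    rw [mul_add, add_mul, add_sub_add_comm, epsEnd_add, h, h', epsEnd_add]
    simp only [mul_add, add_mul]; abel
  · intro c T h
    rw [mul_smul_comm, smul_mul_assoc, ← smul_sub, epsEnd_smul, h, epsEnd_smul, mul_smul_comm,
      smul_mul_assoc, smul_sub]

theorem deriv_mul {D : Module.End F A} (hD : D ∈ instrl F A) (h1 : D 1 = 0) (x y : A) :
    D (x * y) = D x * y + x * D y := by
  have he : epsEnd D = D := by ext z; simp [epsEnd_apply, h1]
  have key : ∀ x y z, D (opV F x y z) = opV F (D x) y z + opV F x (D y) z + opV F x y (D z) := by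
    intro x y z
    have h := LinearMap.congr_fun (instrl_opV hD x y) z
    rw [he] at h
    simp only [LinearMap.sub_apply, LinearMap.add_apply, Module.End.mul_apply] at h
    linear_combination (norm := abel) h
  have hs : ∀ x, D (star x) = star (D x) := by
    intro x
    have h := key x 1 1
    simp only [opV_apply, h1, star_one, mul_one, one_mul, map_sub, map_add, star_zero, mul_zero,
      zero_mul, add_zero, sub_zero] at h
    linear_combination (norm := abel) -h
  have ha := key (star x) 1 y
  have hb := key (star x) (star y) 1
  have hc := key y 1 x
  simp only [opV_apply, h1, star_one, mul_one, one_mul, map_sub, map_add, star_zero, mul_zero,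
      zero_mul, add_zero, sub_zero, star_star, hs] at ha hb hc
  linear_combination (norm := abel) ha - hb + hc

theorem opV_skew [NeZero (2 : F)] (a : A) (s : skewPart F A) (x : A) :
    opV F a 1 (s * x) = (opV F a 1 s + s * star (opV F a 1 1)) * x + s * epsEnd (opV F a 1) x := by
  let t : skewPart F A := ⟨a - star a, by change star _ = -_; simp⟩
  have ht : (t : A) = a - star a := rfl
  have e1 := assoc_skew s a x
  have e3 := assoc_skew_right t (s : A) x
  rw [ht] at e3
  rw [epsEnd_opV]
  simp [associator, mul_sub, sub_mul, mul_add, add_mul] at e1 e3 ⊢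
  linear_combination (norm := abel) e3 - e1

theorem instrl_skew [NeZero (2 : F)] [NeZero (3 : F)] {T : Module.End F A} (hT : T ∈ instrl F A)
    (s : skewPart F A) (x : A) :
    T (s * x) = (T s + s * star (T 1)) * x + s * epsEnd T x := by
  have h3 : (3 : F) ≠ 0 := NeZero.ne 3
  obtain ⟨a, ha⟩ : ∃ a : A, opV F a 1 1 = T 1 := by
    refine ⟨(3 : F)⁻¹ • (T 1 + T 1 + star (T 1)), ?_⟩
    have : T 1 = (3 : F)⁻¹ • ((3 : F) • T 1) := by rw [smul_smul, inv_mul_cancel₀ h3, one_smul]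
    rw [opV_smul, LinearMap.smul_apply]
    conv_rhs => rw [this]
    congr 1
    have h4 : (3 : F) • T 1 = T 1 + T 1 + T 1 := by
      rw [show (3 : F) = 1 + 1 + 1 by norm_num, add_smul, add_smul, one_smul]
    rw [h4]
    simp
    abel
  have hd := deriv_mul (sub_mem hT (opV_mem (F := F) a 1)) (by simp [ha, -opV_apply]) (s : A) x
  have hv := opV_skew a s x
  rw [epsEnd_apply] at hv ⊢
  rw [ha] at hv
  simp only [LinearMap.sub_apply, mul_sub, sub_mul, add_mul] at hd hv ⊢
  linear_combination (norm := abel) hd + hv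

theorem delta_opV [NeZero (2 : F)] (s : skewPart F A) (x y : A) :
    opV F x y s + s * star (opV F x y 1) = x * (star y * s) + (s * y) * star x := by
  let r : skewPart F A := ⟨y - star y, by change star _ = -_; simp⟩
  let t : skewPart F A := ⟨x - star x, by change star _ = -_; simp⟩
  have hr : (r : A) = y - star y := rfl
  have ht : (t : A) = x - star x := rfl
  have e1 := assoc_skew_right r (s : A) x
  have e2 := assoc_skew_right t (s : A) y
  have e3 := assoc_skew_right s x (star y)
  have e4 := assoc_skew s x (star y)
  rw [hr] at e1
  rw [ht] at e2
  simp [associator, star_skew, mul_sub, sub_mul, mul_add] at e1 e2 e3 e4 ⊢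
  linear_combination (norm := abel) e2 - e1 + e3 - e4

theorem delta_mem [NeZero (2 : F)] {T : Module.End F A} (hT : T ∈ instrl F A) (s : skewPart F A) :
    T (s : A) + (s : A) * star (T 1) ∈ skewPart F A := by
  refine instrl_induction (p := fun T => T (s : A) + (s : A) * star (T 1) ∈ skewPart F A) ?_ ?_ ?_ ?_ hT
  · intro x y
    change star _ = -_
    have e1 := assoc_skew s (star y) x
    have e2 := assoc_skew s (star x) y
    have e6 := assoc_skew_right s (star x) y
    have e7 := assoc_skew_right s (star y) x
    simp [associator, star_skew, mul_sub, sub_mul, mul_add, add_mul] at e1 e2 e6 e7 ⊢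
    linear_combination (norm := abel) e6 - e2 + e1 - e7
  · simp
  · intro S T hS hT
    have := add_mem hS hT
    convert this using 1
    simp only [LinearMap.add_apply, star_add, mul_add]; abel
  · intro c S hS
    have := (skewPart F A).smul_mem c hS
    convert this using 1
    simp only [LinearMap.smul_apply, IsStructurable.star_smul, mul_smul_comm, smul_add]

theorem mulLeft_mulLeft_mem [NeZero (2 : F)] (r s : skewPart F A) :
    LinearMap.mulLeft F (r : A) * LinearMap.mulLeft F (s : A) ∈ instrl F A := by
  have h : LinearMap.mulLeft F (r : A) * LinearMap.mulLeft F (s : A) =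
      (2 : F)⁻¹ • (opV F ((r : A) * s) 1 - opV F (r : A) (s : A)) := by
    rw [eq_inv_smul_iff₀ (NeZero.ne (2 : F)), two_smul]
    ext z
    have b := assoc_skew_right r z (s : A)
    have c := assoc_skew r z (s : A)
    have d := assoc_skew_right s (r : A) z
    simp [associator, star_skew] at b c d ⊢
    linear_combination (norm := abel) c + c - d - d - b
  rw [h]
  exact SMulMemClass.smul_mem _ (sub_mem (opV_mem _ _) (opV_mem _ _))

/-- The Kantor triple system on `A` with product `{x y z} = V_{x,y}(z)`. -/
def triple (F A : Type*) [Field F] [NonAssocRing A] [StarRing A] [Module F A]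
    [SMulCommClass F A A] [IsScalarTower F A A] [IsStructurable F A]
    [NeZero (2 : F)] [NeZero (3 : F)] : KantorTripleSystem F A where
  triple := LinearMap.mk₂ F (opV F) opV_add opV_smul opV_add' opV_smul'
  triple_triple u v x y z := by
    have h := LinearMap.congr_fun (IsStructurable.opV_comm (F := F) u v x y) z
    exact h
  kantor u v x y z := by
    simp only [LinearMap.mk₂_apply]
    have key : ∀ a b c : A, opV F a c b - opV F b c a = (psi (F := F) a b : A) * c := by
      intro a b c
      simp [psi, sub_mul]
      abel
    have h := instrl_skew (opV_mem (F := F) y x) (psi (F := F) u v) z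
    have hd := delta_opV (psi (F := F) u v) y x
    rw [epsEnd_opV] at h
    rw [key u v x, key u v (opV F x y z), key u v z, h, hd, key]
    generalize psi (F := F) u v = s
    have hp : (psi (F := F) ((s : A) * x) y : A) = (s * x) * star y + y * (star x * s) := by
      simp [psi, star_skew]
    rw [hp, LinearMap.neg_apply, mul_neg, add_mul, add_mul]
    abel

/-- `T^ε = T - L_{T(1) + conj(T(1))}`, for `T` in `Instrl(A)`. -/
def eps (T : instrl F A) : instrl F A := ⟨epsEnd T, epsEnd_mem T.2⟩

/-- `T^δ(s) = T(s) + s conj(T(1))`, for `T` in `Instrl(A)` and `s` skew-symmetric. -/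
def delta [NeZero (2 : F)] (T : instrl F A) (s : skewPart F A) : skewPart F A :=
  ⟨(T : Module.End F A) s + s * star ((T : Module.End F A) 1), delta_mem T.2 s⟩

/-- `V_{x,y}` as an element of `Instrl(A)`. -/
def innerV (x y : A) : instrl F A := ⟨opV F x y, opV_mem x y⟩

/-- The product `L_r L_s` of left multiplications by skew-symmetric elements, as an element of
`Instrl(A)`. -/
def innerLL [NeZero (2 : F)] (r s : skewPart F A) : instrl F A :=
  ⟨LinearMap.mulLeft F (r : A) * LinearMap.mulLeft F (s : A), mulLeft_mulLeft_mem r s⟩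

end Structurable

/-- The vector space of Allison's algebra `𝒦(A)`: the sum `N~ ⊕ Instrl(A) ⊕ N`, where `N = A × S`
(with `S` the space of skew-symmetric elements) and `N~` is a copy of `N`. -/
def AllisonAlg (F A : Type*) [Field F] [NonAssocRing A] [StarRing A] [Module F A]
    [SMulCommClass F A A] [IsScalarTower F A A] [IsStructurable F A] : Type _ :=
  (A × skewPart F A) × Structurable.instrl F A × (A × skewPart F A)

namespace AllisonAlg

open Structurable

variable {F}
variable [IsStructurable F A]

attribute [local instance] LieRing.ofAssociativeRing

/-- The first component of an element of `N~`. -/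
def y (P : AllisonAlg F A) : A := P.1.1

/-- The second component of an element of `N~`. -/
def t (P : AllisonAlg F A) : skewPart F A := P.1.2

/-- The component in `Instrl(A)`. -/
def op (P : AllisonAlg F A) : instrl F A := P.2.1

/-- The first component of an element of `N`. -/
def x (P : AllisonAlg F A) : A := P.2.2.1

/-- The second component of an element of `N`. -/
def s (P : AllisonAlg F A) : skewPart F A := P.2.2.2

@[ext] theorem ext {P Q : AllisonAlg F A} (hy : P.y = Q.y) (ht : P.t = Q.t) (ho : P.op = Q.op)
    (hx : P.x = Q.x) (hs : P.s = Q.s) : P = Q :=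
  Prod.ext (Prod.ext hy ht) (Prod.ext ho (Prod.ext hx hs))

noncomputable instance : AddCommGroup (AllisonAlg F A) :=
  inferInstanceAs (AddCommGroup ((A × skewPart F A) × instrl F A × (A × skewPart F A)))

noncomputable instance : Module F (AllisonAlg F A) :=
  inferInstanceAs (Module F ((A × skewPart F A) × instrl F A × (A × skewPart F A)))

/-- The bracket of `𝒦(A)`: `Instrl(A)` carries the commutator, and for `T` in `Instrl(A)`
`[T,(x,s)] = (T x, T^δ s)`, `[T,(y,t)~] = (T^ε y, (T^ε)^δ t)~`,
`[(x,s),(x',s')] = (0, ψ(x,x'))`, `[(y,t)~,(y',t')~] = (0, ψ(y,y'))~` and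
`[(x,s),(y,t)~] = -(t x, 0)~ + V_{x,y} + L_s L_t + (s y, 0)`. -/
noncomputable instance [NeZero (2 : F)] : Bracket (AllisonAlg F A) (AllisonAlg F A) where
  bracket P Q :=
    (((eps P.op).1 Q.y - (eps Q.op).1 P.y - ((Q.t : A) * P.x - (P.t : A) * Q.x),
        delta (eps P.op) Q.t - delta (eps Q.op) P.t + psi P.y Q.y),
      ⁅P.op, Q.op⁆ + (innerV P.x Q.y - innerV Q.x P.y) + (innerLL P.s Q.t - innerLL Q.s P.t),
      (P.op.1 Q.x - Q.op.1 P.x + ((P.s : A) * Q.y - (Q.s : A) * P.y),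
        delta P.op Q.s - delta Q.op P.s + psi P.x Q.x))

variable [NeZero (2 : F)] [NeZero (3 : F)]

theorem toLieAlg_mem (P : AllisonAlg F A) :
    (!![P.op.1, LinearMap.mulLeft F (P.s : A); LinearMap.mulLeft F (P.t : A), epsEnd P.op.1] :
      Matrix (Fin 2) (Fin 2) (Module.End F A)) ∈ (triple F A).even := by
  change _ ∈ (triple F A).evenSpan
  have h1 : ∀ T ∈ instrl F A, (!![T, 0; 0, epsEnd T] : Matrix (Fin 2) (Fin 2) (Module.End F A)) ∈
      (triple F A).evenSpan := by
    intro T hT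
    refine instrl_induction (p := fun T => (!![T, 0; 0, epsEnd T] :
      Matrix (Fin 2) (Fin 2) (Module.End F A)) ∈ (triple F A).evenSpan) ?_ ?_ ?_ ?_ hT
    · intro x y
      refine Submodule.subset_span ⟨x, y, 0, 0, 0, 0, ?_⟩
      rw [epsEnd_opV]
      ext i j z
      fin_cases i <;> fin_cases j <;>
        simp [KantorTripleSystem.genMatrix, triple, KantorTripleSystem.L]
    · convert (triple F A).evenSpan.zero_mem using 1
      ext i j z
      fin_cases i <;> fin_cases j <;> simp [epsEnd_zero]
    · intro S T hS hT
      convert add_mem hS hT using 1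
      ext i j z
      fin_cases i <;> fin_cases j <;> simp [epsEnd_add]
    · intro c S hS
      convert (triple F A).evenSpan.smul_mem c hS using 1
      ext i j z
      fin_cases i <;> fin_cases j <;> simp [epsEnd_smul]
  have h2 : ∀ s : skewPart F A, (triple F A).K ((2 : F)⁻¹ • (s : A)) 1 = LinearMap.mulLeft F (s : A) := by
    intro s
    ext z
    have h : (2 : F)⁻¹ • ((s : A) * z) + (2 : F)⁻¹ • ((s : A) * z) = s * z := by
      rw [← two_smul F, smul_smul, mul_inv_cancel₀ (NeZero.ne (2 : F)), one_smul]
    simp [triple, IsStructurable.star_smul, star_skew, smul_add, smul_sub]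
    linear_combination (norm := abel) h
  have h3 : (!![P.op.1, LinearMap.mulLeft F (P.s : A); LinearMap.mulLeft F (P.t : A),
      epsEnd P.op.1] : Matrix (Fin 2) (Fin 2) (Module.End F A)) = !![P.op.1, 0; 0, epsEnd P.op.1] +
      (triple F A).genMatrix 0 0 ((2 : F)⁻¹ • (P.s : A)) 1 ((2 : F)⁻¹ • (P.t : A)) 1 := by
    ext i j z
    fin_cases i <;> fin_cases j <;> simp [KantorTripleSystem.genMatrix, h2, -KantorTripleSystem.K_apply]
  rw [h3]
  exact add_mem (h1 _ P.op.2) (Submodule.subset_span ⟨_, _, _, _, _, _, rfl⟩)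

/-- `𝒦(A)` embeds in the Lie algebra of the Kantor triple system `V_{x,y}(z)`. -/
noncomputable def toLieAlg (P : AllisonAlg F A) : (triple F A).LieAlg :=
  (⟨_, toLieAlg_mem P⟩, ![P.x, P.y])

theorem mat_toLieAlg (P : AllisonAlg F A) : (toLieAlg P).mat =
    !![P.op.1, LinearMap.mulLeft F (P.s : A); LinearMap.mulLeft F (P.t : A), epsEnd P.op.1] := rfl

theorem col_toLieAlg (P : AllisonAlg F A) : (toLieAlg P).col = ![P.x, P.y] := rfl

theorem toLieAlg_injective : Function.Injective (toLieAlg (F := F) (A := A)) := by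
  intro P Q h
  have hm := congrArg KantorTripleSystem.LieAlg.mat h
  have hc := congrArg KantorTripleSystem.LieAlg.col h
  rw [mat_toLieAlg, mat_toLieAlg] at hm
  rw [col_toLieAlg, col_toLieAlg] at hc
  ext
  · exact congrFun hc 1
  · simpa using LinearMap.congr_fun (congrFun (congrFun hm 1) 0) 1
  · exact LinearMap.congr_fun (congrFun (congrFun hm 0) 0) _
  · exact congrFun hc 0
  · simpa using LinearMap.congr_fun (congrFun (congrFun hm 0) 1) 1

theorem toLieAlg_add (P Q : AllisonAlg F A) : toLieAlg (P + Q) = toLieAlg P + toLieAlg Q := by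
  have ho : (P + Q).op.1 = P.op.1 + Q.op.1 := rfl
  have hs : ((P + Q).s : A) = P.s + Q.s := rfl
  have ht : ((P + Q).t : A) = P.t + Q.t := rfl
  have hx : (P + Q).x = P.x + Q.x := rfl
  have hy : (P + Q).y = P.y + Q.y := rfl
  ext i j z
  · rw [KantorTripleSystem.mat_add, mat_toLieAlg, mat_toLieAlg, mat_toLieAlg, ho, hs, ht]
    fin_cases i <;> fin_cases j <;> simp [epsEnd_add, add_mul]
  · rw [KantorTripleSystem.col_add, col_toLieAlg, col_toLieAlg, col_toLieAlg, hx, hy]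
    fin_cases i <;> simp

theorem toLieAlg_smul (c : F) (P : AllisonAlg F A) : toLieAlg (c • P) = c • toLieAlg P := by
  have ho : (c • P).op.1 = c • P.op.1 := rfl
  have hs : ((c • P).s : A) = c • (P.s : A) := rfl
  have ht : ((c • P).t : A) = c • (P.t : A) := rfl
  have hx : (c • P).x = c • P.x := rfl
  have hy : (c • P).y = c • P.y := rfl
  ext i j z
  · rw [KantorTripleSystem.mat_smul, mat_toLieAlg, mat_toLieAlg, ho, hs, ht]
    fin_cases i <;> fin_cases j <;> simp [epsEnd_smul, smul_mul_assoc]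
  · rw [KantorTripleSystem.col_smul, col_toLieAlg, col_toLieAlg, hx, hy]
    fin_cases i <;> simp

theorem toLieAlg_zero : toLieAlg (0 : AllisonAlg F A) = 0 := by
  rw [← zero_smul F (0 : AllisonAlg F A), toLieAlg_smul, zero_smul]

theorem toLieAlg_lie (P Q : AllisonAlg F A) : toLieAlg ⁅P, Q⁆ = ⁅toLieAlg P, toLieAlg Q⁆ := by
  have ho : (⁅P, Q⁆ : AllisonAlg F A).op.1 = P.op.1 * Q.op.1 - Q.op.1 * P.op.1 +
    (opV F P.x Q.y - opV F Q.x P.y) + (LinearMap.mulLeft F (P.s : A) * LinearMap.mulLeft F (Q.t : A)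
      - LinearMap.mulLeft F (Q.s : A) * LinearMap.mulLeft F (P.t : A)) := rfl
  have hs : ((⁅P, Q⁆ : AllisonAlg F A).s : A) = P.op.1 Q.s + Q.s * star (P.op.1 1) -
    (Q.op.1 P.s + P.s * star (Q.op.1 1)) + (P.x * star Q.x - Q.x * star P.x) := rfl
  have ht : ((⁅P, Q⁆ : AllisonAlg F A).t : A) =
    epsEnd P.op.1 Q.t + Q.t * star (epsEnd P.op.1 1) -
    (epsEnd Q.op.1 P.t + P.t * star (epsEnd Q.op.1 1)) + (P.y * star Q.y - Q.y * star P.y) := rfl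
  have hx : (⁅P, Q⁆ : AllisonAlg F A).x =
    P.op.1 Q.x - Q.op.1 P.x + (P.s * Q.y - Q.s * P.y) := rfl
  have hy : (⁅P, Q⁆ : AllisonAlg F A).y =
    epsEnd P.op.1 Q.y - epsEnd Q.op.1 P.y - (Q.t * P.x - P.t * Q.x) := rfl
  have hneg : ∀ S : Module.End F A, epsEnd (-S) = -epsEnd S := by
    intro S; rw [← neg_one_smul F S, epsEnd_smul, neg_one_smul]
  have hsub : ∀ S T : Module.End F A, epsEnd (S - T) = epsEnd S - epsEnd T := by
    intro S T; rw [sub_eq_add_neg, epsEnd_add, hneg, sub_eq_add_neg]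
  have hLL : ∀ r s : skewPart F A, epsEnd (LinearMap.mulLeft F (r : A) *
      LinearMap.mulLeft F (s : A)) =
      -(LinearMap.mulLeft F (s : A) * LinearMap.mulLeft F (r : A)) := by
    intro r s
    ext z
    have h := assoc_skew r (s : A) z
    simp [epsEnd_apply, star_skew, associator, add_mul] at h ⊢
    linear_combination (norm := abel) -h
  have hKx : ∀ a b z : A, opV F a z b - opV F b z a = (a * star b - b * star a) * z := by
    intro a b z
    simp [sub_mul]
    abel
  ext i j z
  · rw [KantorTripleSystem.mat_lie, mat_toLieAlg, mat_toLieAlg, mat_toLieAlg, col_toLieAlg,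
      col_toLieAlg, ho, hs, ht]
    fin_cases i <;> fin_cases j <;>
      simp [KantorTripleSystem.colBracket, LieRing.of_associative_ring_bracket,
        triple, KantorTripleSystem.L, -opV_apply]
    · abel
    · have h1 := instrl_skew P.op.2 Q.s z
      have h2 := instrl_skew Q.op.2 P.s z
      rw [hKx]
      simp only [add_mul, sub_mul] at h1 h2 ⊢
      linear_combination (norm := abel) h2 - h1
    · have h1 := instrl_skew (epsEnd_mem P.op.2) Q.t z
      have h2 := instrl_skew (epsEnd_mem Q.op.2) P.t z
      rw [epsEnd_epsEnd] at h1 h2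
      rw [hKx]
      simp only [add_mul, sub_mul] at h1 h2 ⊢
      linear_combination (norm := abel) h2 - h1
    · rw [epsEnd_add, epsEnd_add, hsub (opV F _ _), hsub (_ * LinearMap.mulLeft F _), hLL, hLL,
        epsEnd_lie P.op.2 Q.op.2, epsEnd_opV, epsEnd_opV]
      simp [-opV_apply]
      abel
  · rw [KantorTripleSystem.col_lie, mat_toLieAlg, mat_toLieAlg, col_toLieAlg, col_toLieAlg,
      col_toLieAlg, hx, hy]
    fin_cases i <;> simp [KantorTripleSystem.act] <;> abel

noncomputable instance : LieRing (AllisonAlg F A) where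
  add_lie P Q R := toLieAlg_injective (by simp only [toLieAlg_lie, toLieAlg_add, add_lie])
  lie_add P Q R := toLieAlg_injective (by simp only [toLieAlg_lie, toLieAlg_add, lie_add])
  lie_self P := toLieAlg_injective (by rw [toLieAlg_lie, lie_self, toLieAlg_zero])
  leibniz_lie P Q R := toLieAlg_injective (by
    simp only [toLieAlg_lie, toLieAlg_add]
    exact leibniz_lie _ _ _)

noncomputable instance : LieAlgebra F (AllisonAlg F A) where
  lie_smul c P Q := toLieAlg_injective (by simp only [toLieAlg_lie, toLieAlg_smul, lie_smul])

/-- The homogeneous components of the `5`-grading of `𝒦(A)`: `(0,S)~`, `(A,0)~`, `Instrl(A)`,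
`(A,0)`, `(0,S)` in degrees `-2`, `-1`, `0`, `1`, `2`, and zero in all other degrees. -/
def grading (F A : Type*) [Field F] [NonAssocRing A] [StarRing A] [Module F A]
    [SMulCommClass F A A] [IsScalarTower F A A] [IsStructurable F A] (i : ℤ) :
    Submodule F (AllisonAlg F A) where
  carrier := {P | (i ≠ -2 → P.t = 0) ∧ (i ≠ -1 → P.y = 0) ∧ (i ≠ 0 → P.op = 0) ∧
    (i ≠ 1 → P.x = 0) ∧ (i ≠ 2 → P.s = 0)}
  add_mem' {P Q} hP hQ := by
    obtain ⟨h1, h2, h3, h4, h5⟩ := hP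
    obtain ⟨k1, k2, k3, k4, k5⟩ := hQ
    refine ⟨fun h => ?_, fun h => ?_, fun h => ?_, fun h => ?_, fun h => ?_⟩
    · exact (congrArg₂ (· + ·) (h1 h) (k1 h)).trans (add_zero 0)
    · exact (congrArg₂ (· + ·) (h2 h) (k2 h)).trans (add_zero 0)
    · exact (congrArg₂ (· + ·) (h3 h) (k3 h)).trans (add_zero 0)
    · exact (congrArg₂ (· + ·) (h4 h) (k4 h)).trans (add_zero 0)
    · exact (congrArg₂ (· + ·) (h5 h) (k5 h)).trans (add_zero 0)
  zero_mem' := ⟨fun _ => rfl, fun _ => rfl, fun _ => rfl, fun _ => rfl, fun _ => rfl⟩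
  smul_mem' c P hP := by
    obtain ⟨h1, h2, h3, h4, h5⟩ := hP
    refine ⟨fun h => ?_, fun h => ?_, fun h => ?_, fun h => ?_, fun h => ?_⟩
    · exact (congrArg (c • ·) (h1 h)).trans (smul_zero c)
    · exact (congrArg (c • ·) (h2 h)).trans (smul_zero c)
    · exact (congrArg (c • ·) (h3 h)).trans (smul_zero c)
    · exact (congrArg (c • ·) (h4 h)).trans (smul_zero c)
    · exact (congrArg (c • ·) (h5 h)).trans (smul_zero c)

end AllisonAlg

end Structurable

/-- For `h` in `L` spanning a one-dimensional abelian subalgebra with root `α` such that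
`α(h) = 2`, the weight space `L_{kα} = {x : [h,x] = 2k x}`. -/
noncomputable def bc1WeightSpace (F : Type*) {L : Type*} [Field F] [LieRing L] [LieAlgebra F L]
    (h : L) (k : ℤ) : Submodule F L :=
  (LieAlgebra.ad F L h).eigenspace ((2 * k : ℤ) : F)

/-- `L` is graded over the nonreduced root system `BC₁ = {±α, ±2α}` and of type `B₁`:
`L` contains, as image of `θ`, a split simple three-dimensional Lie algebra, with split Cartan
subalgebra spanned by the image `h` of `diag(1,-1)` and with root system `{±α}`, `α(h) = 2`;
`L` is the direct sum of its weight spaces `L_{kα}` relative to `h` for `k = -2, -1, 0, 1, 2`;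
and `L_0` is spanned by all the brackets `[L_μ, L_{-μ}]`, `μ` in `BC₁`. -/
def IsBC1GradedOfTypeB1 (F L : Type*) [Field F] [LieRing L] [LieAlgebra F L] : Prop :=
  ∃ (θ : LieAlgebra.SpecialLinear.sl (Fin 2) F →ₗ⁅F⁆ L) (h : L),
    Function.Injective θ ∧ h = θ (LieAlgebra.SpecialLinear.singleSubSingle 0 1 1) ∧
    DirectSum.IsInternal (fun k : Finset.Icc (-2 : ℤ) 2 => bc1WeightSpace F h k) ∧
    bc1WeightSpace F h 0 = Submodule.span F
      {z | ∃ k ∈ Finset.Icc (-2 : ℤ) 2, k ≠ 0 ∧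
        ∃ a ∈ bc1WeightSpace F h k, ∃ b ∈ bc1WeightSpace F h (-k), z = ⁅a, b⁆}

universe u v

/-! Fix a left unit e and write R x = xee, C x = exe. The second axiom gives (R - 1)(R - 3) = 0, so
U = H ⊕ S with R = 1 on H and R = 3 on S. The first axiom gives C² = R², and R commutes with C. If U
came from a structurable algebra with e = 1, then H and S would be its symmetric and skew elements,
and C would be 1 on H and -3 on S.

For a general left unit, C differs from this model by the operator τ equal to C on H and to -C/3 on
S. The key fact (`IsLeftUnit.twist_triple`) is that τ is an automorphism of the triple product with
τ² = 1. Hence x(τy)z is again a Kantor product with left unit e (`untwist`), and for it C = 3 - 2R,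
as in the model (`untwist_conj`).

For such a normalized unit the algebra structure is forced: the involution is 2 - R, an element h of
H multiplies from the left as L(h,e), and an element s of S as K(s,e)/2. Two facts make this
structurable: a skew element satisfies (s,y,z) = -(y,s,z) (`IsNormalizedUnit.skew_anticomm`), and
the triple product is V_{x,y}z (`UnitalAlg.tri_eq_opV`), so that the first axiom becomes the
commutator identity for the operators V.

The pair (id, τ), acting as id on the first entries of columns and as τ on the second, carries the
original product to V_{x,y}z and so induces a graded isomorphism of Lie algebras. On the triple
system of a structurable algebra A one has K(a,b) = L_{ψ(a,b)} and V_{x,y}^ε = -V_{y,x}, which makes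
the embedding `toLieAlg` of 𝒦(A) surjective and graded.

For the last claim, (e,0) and (0,2e) generate a copy of 𝔰𝔩₂ whose h acts as 2i on the component of
degree i. These eigenvalues are distinct because 2 and 3 are invertible, so the weight decomposition
is the 5-grading, and degree 0 is already spanned by brackets of degrees 1 and -1. -/

namespace KantorTripleSystem

variable {F U : Type*} [Field F] [AddCommGroup U] [Module F U] (T : KantorTripleSystem F U)

/-! ### The operators R : x ↦ xee and C : x ↦ exe of a left unit. -/

section LeftUnit

variable {T} {e : U}

theorem IsLeftUnit.unit_apply (he : T.IsLeftUnit e) (z : U) : T.triple e e z = z :=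
  LinearMap.congr_fun he z

/-- `L(e, exe) = L(xee, e)`. -/
theorem IsLeftUnit.triple_unit_conj (he : T.IsLeftUnit e) (x z : U) :
    T.triple e (T.triple e x e) z = T.triple (T.triple x e e) e z := by
  have h := T.triple_triple x e e e z
  simp only [he.unit_apply] at h
  linear_combination (norm := module) h

theorem IsLeftUnit.conj_conj (he : T.IsLeftUnit e) (x : U) :
    T.triple e (T.triple e x e) e = T.triple (T.triple x e e) e e :=
  he.triple_unit_conj x e

/-- `K(K(u,v)e, e) = 2 K(u,v)`. -/
theorem IsLeftUnit.kantor_unit (he : T.IsLeftUnit e) (u v z : U) :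
    T.K (T.K u v e) e z = (2 : F) • T.K u v z := by
  have h := T.kantor u v e e z
  simp only [he.unit_apply] at h
  simp only [K_apply, map_sub, LinearMap.sub_apply] at h ⊢
  linear_combination (norm := module) h

/-- Since K(x,e)e = (R - 1)x, the relation `kantor_unit` evaluated at e reads (R - 1)² = 2(R - 1),
that is, (R - 1)(R - 3) = 0. -/
theorem IsLeftUnit.right_right (he : T.IsLeftUnit e) (x : U) :
    T.triple (T.triple x e e) e e = (4 : F) • T.triple x e e - (3 : F) • x := by
  have h := he.kantor_unit x e e
  simp only [K_apply, map_sub, LinearMap.sub_apply, he.unit_apply] at h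
  linear_combination (norm := module) h

theorem smul_cancel {c : F} (hc : c ≠ 0) {x y : U} (h : c • x = c • y) : x = y :=
  smul_right_injective U hc h

/-- The operators `x ↦ xee` and `x ↦ exe` commute. -/
theorem IsLeftUnit.conj_right [NeZero (2 : F)] (he : T.IsLeftUnit e) (x : U) :
    T.triple e (T.triple x e e) e = T.triple (T.triple e x e) e e := by
  -- Computing C³ in two ways gives R²C = CR². After R² = 4R - 3 is inserted, 4(RC - CR) = 0
  -- remains.
  have h1 := he.conj_conj (T.triple e x e)
  have h2 := congrArg (fun y => T.triple e y e) (he.conj_conj x)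
  simp only [he.right_right, map_sub, map_smul, LinearMap.sub_apply, LinearMap.smul_apply]
    at h1 h2
  refine smul_cancel (F := F) (c := 2 * 2) (mul_ne_zero (NeZero.ne 2) (NeZero.ne 2)) ?_
  linear_combination (norm := module) h1 - h2

/-- `L(x, eye) = L(yex, e) - [L(y,e), L(x,e)]`. -/
theorem triple_conj (x y z : U) :
    T.triple x (T.triple e y e) z = T.triple (T.triple y e x) e z -
      (T.triple y e (T.triple x e z) - T.triple x e (T.triple y e z)) := by
  linear_combination (norm := module) T.triple_triple y e x e z

/-- `L(e, ey(exe)) = L(yee, exe) - [L(y,e), L(xee,e)]`. -/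
theorem IsLeftUnit.triple_unit_triple (he : T.IsLeftUnit e) (x y z : U) :
    T.triple e (T.triple e y (T.triple e x e)) z =
      T.triple (T.triple y e e) (T.triple e x e) z -
      (T.triple y e (T.triple (T.triple x e e) e z) -
        T.triple (T.triple x e e) e (T.triple y e z)) := by
  have h := T.triple_triple y e e (T.triple e x e) z
  rw [he.triple_unit_conj, he.triple_unit_conj] at h
  linear_combination (norm := module) h

/-- The witnesses are the projections (3 - R)/2 and (R - 1)/2 onto the two eigenspaces of R, the
future symmetric and skew elements. -/
theorem exists_sym_add_skew [NeZero (2 : F)] (he : T.IsLeftUnit e) (x : U) :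
    ∃ h s, T.triple h e e = h ∧ T.triple s e e = (3 : F) • s ∧ x = h + s := by
  have h2 : (2 : F) ≠ 0 := NeZero.ne 2
  refine ⟨(2 : F)⁻¹ • ((3 : F) • x - T.triple x e e), (2 : F)⁻¹ • (T.triple x e e - x), ?_, ?_, ?_⟩
  · simp only [map_sub, map_smul, LinearMap.sub_apply, LinearMap.smul_apply, he.right_right]
    module
  · simp only [map_sub, map_smul, LinearMap.sub_apply, LinearMap.smul_apply, he.right_right]
    module
  · rw [← smul_add, eq_inv_smul_iff₀ h2]
    module

section Sym

variable {h k s t : U}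

/-- By `kantor_unit`, K(h,e) is determined by its value K(h,e)e = (R - 1)h = 0, so K(h,e) vanishes.
-/
theorem IsLeftUnit.K_sym [NeZero (2 : F)] (he : T.IsLeftUnit e) (hh : T.triple h e e = h)
    (z : U) : T.triple h z e = T.triple e z h := by
  have h1 := he.kantor_unit h e z
  simp only [K_apply, hh, he.unit_apply, sub_self, map_zero, LinearMap.zero_apply] at h1
  refine smul_cancel (F := F) (NeZero.ne 2) ?_
  linear_combination (norm := module) -h1

/-- `2 K(s,y) = K(s,e) L(e,y) + L(y,e) K(s,e)` for `s` skew. -/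
theorem IsLeftUnit.K_skew (he : T.IsLeftUnit e) (hs : T.triple s e e = (3 : F) • s) (y z : U) :
    (2 : F) • T.K s y z = T.K s e (T.triple e y z) + T.triple y e (T.K s e z) := by
  have h1 := T.kantor s e e y z
  simp only [hs, he.unit_apply, K_apply, map_sub, map_smul, LinearMap.sub_apply,
    LinearMap.smul_apply] at h1 ⊢
  linear_combination (norm := module) h1

theorem IsLeftUnit.K_skew_conj (he : T.IsLeftUnit e) (hs : T.triple s e e = (3 : F) • s) (y : U) :
    T.K s e (T.triple e y e) = (2 : F) • T.triple s e y - (4 : F) • T.triple y e s := by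
  have h1 := he.K_skew hs y e
  have h2 : T.K s e e = (2 : F) • s := by
    rw [K_apply, hs, he.unit_apply]; module
  rw [h2, K_apply T s y] at h1
  simp only [map_smul] at h1
  linear_combination (norm := module) -h1

/-- This lemma and the next three describe R on products xez of eigenvectors. The source is
`triple_conj` evaluated at e, whose left side x(eye)e is computed from K(x,e): this operator is zero
for symmetric x and is governed by `K_skew_conj` for skew x. -/
theorem IsLeftUnit.right_sym_sym [NeZero (2 : F)] (he : T.IsLeftUnit e)
    (hh : T.triple h e e = h) (hk : T.triple k e e = k) :
    T.triple (T.triple h e k) e e = (2 : F) • T.triple h e k - T.triple k e h := by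
  have h1 := triple_conj (T := T) (e := e) k h e
  rw [he.K_sym hk, he.triple_unit_conj, hh, hk] at h1
  linear_combination (norm := module) -h1

theorem IsLeftUnit.right_sym_skew (he : T.IsLeftUnit e)
    (hh : T.triple h e e = h) (hs : T.triple s e e = (3 : F) • s) :
    T.triple (T.triple h e s) e e = T.triple s e h := by
  have h1 := triple_conj (T := T) (e := e) s h e
  have h2 := he.K_skew_conj hs h
  rw [K_apply, he.triple_unit_conj] at h2
  simp only [hh, hs, map_smul] at h1 h2
  linear_combination (norm := module) h2 - h1

theorem IsLeftUnit.right_skew_sym (he : T.IsLeftUnit e)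
    (hh : T.triple h e e = h) (hs : T.triple s e e = (3 : F) • s) :
    T.triple (T.triple s e h) e e = (4 : F) • T.triple s e h - (3 : F) • T.triple h e s := by
  have h1 := he.right_right (T.triple h e s)
  rwa [he.right_sym_skew hh hs] at h1

theorem IsLeftUnit.right_skew_skew (he : T.IsLeftUnit e)
    (hs : T.triple s e e = (3 : F) • s) (ht : T.triple t e e = (3 : F) • t) :
    T.triple (T.triple t e s) e e = (2 : F) • T.triple t e s - T.triple s e t := by
  have h1 := triple_conj (T := T) (e := e) s t e
  have h2 := he.K_skew_conj hs t
  rw [K_apply, he.triple_unit_conj] at h2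
  simp only [ht, hs, map_smul, LinearMap.smul_apply] at h1 h2
  linear_combination (norm := module) h2 - h1

end Sym

end LeftUnit

end KantorTripleSystem

/-! ### The automorphism τ and the normalized triple product x(τy)z. -/

namespace KantorTripleSystem

variable {F U : Type*} [Field F] [AddCommGroup U] [Module F U] (T : KantorTripleSystem F U)

/-- For a left unit `e`, the operator `τ` that agrees with `x ↦ exe` where `xee = x`, and with
`x ↦ -(1/3) exe` where `xee = 3x`. -/
def twist (e : U) : Module.End F U :=
  (3 : F)⁻¹ • ((5 : F) • (T.triple e).flip e -
    (2 : F) • (T.triple e).flip e * (T.triple.flip e).flip e)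

section LeftUnit

variable {T} {e : U} {h k s t : U}

theorem three_smul_twist [NeZero (3 : F)] (e x : U) : (3 : F) • T.twist e x =
    (5 : F) • T.triple e x e - (2 : F) • T.triple e (T.triple x e e) e := by
  simp [twist, smul_smul, NeZero.ne (3 : F)]

theorem twist_sym [NeZero (3 : F)] (hh : T.triple h e e = h) :
    T.twist e h = T.triple e h e := by
  refine smul_cancel (F := F) (NeZero.ne 3) ?_
  rw [three_smul_twist, hh]; module

theorem three_smul_twist_skew [NeZero (3 : F)] (hs : T.triple s e e = (3 : F) • s) :
    (3 : F) • T.twist e s = -T.triple e s e := by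
  rw [three_smul_twist, hs]; simp only [map_smul, LinearMap.smul_apply]; module

variable [NeZero (2 : F)]

theorem IsLeftUnit.right_conj_sym (he : T.IsLeftUnit e) (hh : T.triple h e e = h) :
    T.triple (T.triple e h e) e e = T.triple e h e := by
  rw [← he.conj_right, hh]

theorem IsLeftUnit.right_conj_skew (he : T.IsLeftUnit e) (hs : T.triple s e e = (3 : F) • s) :
    T.triple (T.triple e s e) e e = (3 : F) • T.triple e s e := by
  rw [← he.conj_right, hs, map_smul, LinearMap.smul_apply]

theorem IsLeftUnit.conj_conj_sym (he : T.IsLeftUnit e) (hh : T.triple h e e = h) :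
    T.triple e (T.triple e h e) e = h := by
  rw [he.conj_conj, hh, hh]

theorem IsLeftUnit.conj_conj_skew (he : T.IsLeftUnit e) (hs : T.triple s e e = (3 : F) • s) :
    T.triple e (T.triple e s e) e = (9 : F) • s := by
  rw [he.conj_conj, hs, map_smul, LinearMap.smul_apply, LinearMap.smul_apply, hs]; module

/-- This is `triple_unit_triple` with eye in the middle, evaluated at e. Because L(e, Cy) = L(Ry,
e), it expresses C of a product with middle entry e through R and other products with middle entry
e. -/
theorem IsLeftUnit.conj_triple (he : T.IsLeftUnit e) (x y : U) :
    T.triple e (T.triple (T.triple y e e) e (T.triple e x e)) e =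
      T.triple (T.triple x e (T.triple (T.triple e y e) e e)) e e -
      T.triple x e (T.triple (T.triple (T.triple e y e) e e) e e) +
      T.triple (T.triple (T.triple e y e) e e) e (T.triple x e e) -
      T.triple (T.triple e y e) e (T.triple (T.triple x e e) e e) +
      T.triple (T.triple x e e) e (T.triple (T.triple e y e) e e) := by
  have h1 := he.triple_unit_triple x (T.triple e y e) e
  rw [he.triple_unit_conj, triple_conj] at h1
  linear_combination (norm := module) h1

variable [NeZero (3 : F)]

theorem nine_ne_zero : (9 : F) ≠ 0 := by
  rw [show (9 : F) = 3 * 3 by norm_num]; exact mul_ne_zero (NeZero.ne 3) (NeZero.ne 3)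

theorem IsLeftUnit.twist_sym_sym (he : T.IsLeftUnit e)
    (hh : T.triple h e e = h) (hk : T.triple k e e = k) :
    T.twist e (T.triple h e k) = T.triple (T.twist e h) e (T.twist e k) := by
  have hh' := he.right_conj_sym hh
  have hk' := he.right_conj_sym hk
  have h1 := he.conj_triple (T.triple e k e) h
  have h2 := he.conj_triple (T.triple e h e) k
  simp only [he.conj_conj_sym hh, he.conj_conj_sym hk, hh, hh', hk, hk',
    he.right_sym_sym hh' hk', he.right_sym_sym hk' hh'] at h1 h2
  refine smul_cancel (F := F) (NeZero.ne 3) ?_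
  -- By `right_sym_sym`, 3τ(hek) = C(hek) + 2C(keh), which explains the combination below.
  rw [three_smul_twist, he.right_sym_sym hh hk, twist_sym hh, twist_sym hk]
  simp only [map_sub, map_smul, LinearMap.sub_apply, LinearMap.smul_apply]
  linear_combination (norm := module) h1 + (2 : F) • h2

/-- R mixes hes with seh, so τ of either product involves C of both. -/
theorem IsLeftUnit.conj_sym_skew (he : T.IsLeftUnit e)
    (hh : T.triple h e e = h) (hs : T.triple s e e = (3 : F) • s) :
    (3 : F) • T.triple e (T.triple h e s) e =
      (2 : F) • T.triple (T.triple e s e) e (T.triple e h e) -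
      (3 : F) • T.triple (T.triple e h e) e (T.triple e s e) ∧
    (3 : F) • T.triple e (T.triple s e h) e =
      (5 : F) • T.triple (T.triple e s e) e (T.triple e h e) -
      (6 : F) • T.triple (T.triple e h e) e (T.triple e s e) := by
  have hh' := he.right_conj_sym hh
  have hs' := he.right_conj_skew hs
  have h1 := he.conj_triple (T.triple e s e) h
  have h2 := he.conj_triple (T.triple e h e) s
  simp only [he.conj_conj_sym hh, he.conj_conj_skew hs, hh, hh', hs, hs', map_smul,
    LinearMap.smul_apply, he.right_sym_skew hh' hs', he.right_skew_sym hh' hs'] at h1 h2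
  constructor
  · refine smul_cancel (F := F) (NeZero.ne 3) ?_
    linear_combination (norm := module) h1
  · linear_combination (norm := module) h2

theorem IsLeftUnit.twist_sym_skew (he : T.IsLeftUnit e)
    (hh : T.triple h e e = h) (hs : T.triple s e e = (3 : F) • s) :
    T.twist e (T.triple h e s) = T.triple (T.twist e h) e (T.twist e s) := by
  obtain ⟨h1, h2⟩ := he.conj_sym_skew hh hs
  refine smul_cancel (F := F) nine_ne_zero ?_
  have h3 := congrArg (T.triple (T.twist e h) e) (three_smul_twist_skew hs)
  have h4 := three_smul_twist (T := T) e (T.triple h e s)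
  rw [he.right_sym_skew hh hs] at h4
  simp only [map_smul, map_neg, twist_sym hh] at h3 ⊢
  linear_combination (norm := module) (3 : F) • h4 + (5 : F) • h1 - (2 : F) • h2 - (3 : F) • h3

theorem IsLeftUnit.twist_skew_sym (he : T.IsLeftUnit e)
    (hh : T.triple h e e = h) (hs : T.triple s e e = (3 : F) • s) :
    T.twist e (T.triple s e h) = T.triple (T.twist e s) e (T.twist e h) := by
  obtain ⟨h1, h2⟩ := he.conj_sym_skew hh hs
  refine smul_cancel (F := F) nine_ne_zero ?_
  have h3 := congrArg (fun x => T.triple x e (T.twist e h)) (three_smul_twist_skew hs)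
  have h4 := three_smul_twist (T := T) e (T.triple s e h)
  rw [he.right_skew_sym hh hs] at h4
  simp only [map_smul, map_neg, map_sub, LinearMap.sub_apply, LinearMap.smul_apply,
    LinearMap.neg_apply, twist_sym hh] at h3 h4 ⊢
  linear_combination (norm := module) (3 : F) • h4 - (3 : F) • h2 + (6 : F) • h1 - (3 : F) • h3

theorem IsLeftUnit.twist_skew_skew (he : T.IsLeftUnit e)
    (hs : T.triple s e e = (3 : F) • s) (ht : T.triple t e e = (3 : F) • t) :
    T.twist e (T.triple s e t) = T.triple (T.twist e s) e (T.twist e t) := by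
  have hs' := he.right_conj_skew hs
  have ht' := he.right_conj_skew ht
  have h1 := he.conj_triple (T.triple e t e) s
  have h2 := he.conj_triple (T.triple e s e) t
  simp only [he.conj_conj_skew ht, he.conj_conj_skew hs, ht, ht', hs, hs', map_smul,
    LinearMap.smul_apply, he.right_skew_skew hs' ht', he.right_skew_skew ht' hs'] at h1 h2
  have h4 := three_smul_twist (T := T) e (T.triple s e t)
  rw [he.right_skew_skew ht hs] at h4
  have h5 : (9 : F) • T.triple (T.twist e s) e (T.twist e t) =
      T.triple (T.triple e s e) e (T.triple e t e) := by
    have := congrArg₂ (fun x y => T.triple x e y) (three_smul_twist_skew hs)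
      (three_smul_twist_skew ht)
    simp only [map_smul, map_neg, LinearMap.smul_apply, LinearMap.neg_apply] at this
    linear_combination (norm := module) this
  refine smul_cancel (F := F) (c := 9 * 9) (mul_ne_zero nine_ne_zero nine_ne_zero) ?_
  simp only [map_smul, map_neg, map_sub, LinearMap.sub_apply, LinearMap.smul_apply,
    LinearMap.neg_apply] at h4 ⊢
  linear_combination (norm := module) (27 : F) • h4 - (9 : F) • h5 + h1 + (2 : F) • h2

theorem IsLeftUnit.twist_twist (he : T.IsLeftUnit e) (x : U) : T.twist e (T.twist e x) = x := by
  obtain ⟨h, s, hh, hs, rfl⟩ := exists_sym_add_skew he x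
  have h1 : T.twist e (T.twist e h) = h := by
    rw [twist_sym hh, twist_sym (he.right_conj_sym hh), he.conj_conj_sym hh]
  have h2 : T.twist e (T.twist e s) = s := by
    have h3 := congrArg (T.twist e) (three_smul_twist_skew hs)
    have h4 := three_smul_twist_skew (he.right_conj_skew hs)
    rw [he.conj_conj_skew hs] at h4
    simp only [map_smul, map_neg] at h3
    refine smul_cancel (F := F) nine_ne_zero ?_
    linear_combination (norm := module) (3 : F) • h3 - h4
  rw [map_add, map_add, h1, h2]

theorem IsLeftUnit.twist_unit (he : T.IsLeftUnit e) : T.twist e e = e := by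
  rw [twist_sym (he.unit_apply e), he.unit_apply]

theorem IsLeftUnit.twist_triple_unit (he : T.IsLeftUnit e) (x z : U) :
    T.twist e (T.triple x e z) = T.triple (T.twist e x) e (T.twist e z) := by
  obtain ⟨h, s, hh, hs, rfl⟩ := exists_sym_add_skew he x
  obtain ⟨k, t, hk, ht, rfl⟩ := exists_sym_add_skew he z
  simp only [map_add, LinearMap.add_apply, he.twist_sym_sym hh hk, he.twist_sym_skew hh ht,
    he.twist_skew_sym hk hs, he.twist_skew_skew hs ht]

theorem IsLeftUnit.twist_conj (he : T.IsLeftUnit e) (x : U) :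
    T.twist e (T.triple e x e) = T.triple e (T.twist e x) e := by
  refine smul_cancel (F := F) (NeZero.ne 3) ?_
  have h := congrArg (fun y => T.triple e y e) (three_smul_twist (T := T) e x)
  simp only [map_smul, map_sub, LinearMap.sub_apply, LinearMap.smul_apply, he.conj_right] at h
  rw [three_smul_twist, ← he.conj_right]
  simp only [he.conj_right]
  linear_combination (norm := module) -h

/-- C² = R² is 1 on H and 9 on S, so C is invertible when 3 is. This lets any middle entry be
written as ewe. -/
theorem IsLeftUnit.exists_conj (he : T.IsLeftUnit e) (y : U) : ∃ w, T.triple e w e = y := by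
  obtain ⟨h, s, hh, hs, rfl⟩ := exists_sym_add_skew he y
  refine ⟨T.triple e h e + (9 : F)⁻¹ • T.triple e s e, ?_⟩
  simp only [map_add, map_smul, LinearMap.add_apply, LinearMap.smul_apply,
    he.conj_conj_sym hh, he.conj_conj_skew hs, smul_smul]
  rw [inv_mul_cancel₀ nine_ne_zero, one_smul]

/-- `τ` is an automorphism of the triple product. -/
theorem IsLeftUnit.twist_triple (he : T.IsLeftUnit e) (x y z : U) :
    T.twist e (T.triple x y z) = T.triple (T.twist e x) (T.twist e y) (T.twist e z) := by
  -- For y = ewe, `triple_conj` writes L(x,y) in terms of products with middle entry e, which τ is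
  -- already known to respect.
  obtain ⟨w, rfl⟩ := he.exists_conj y
  rw [he.twist_conj, triple_conj, triple_conj]
  simp only [map_sub, he.twist_triple_unit]

/-- The Kantor triple system with product `x (τ y) z`. -/
def untwist (he : T.IsLeftUnit e) : KantorTripleSystem F U where
  triple := LinearMap.mk₂ F (fun x y => T.triple x (T.twist e y))
    (by intros; simp) (by intros; simp) (by intros; simp) (by intros; simp)
  triple_triple u v x y z := by
    have h := T.triple_triple u (T.twist e v) x (T.twist e y) z
    simpa [he.twist_triple, he.twist_twist] using h
  kantor u v x y z := by
    -- For the new product K'(u,v) = K(u,v)τ, so the old identity is needed at τx and τz.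
    have h := T.kantor u v (T.twist e x) y (T.twist e z)
    simpa [he.twist_triple, he.twist_twist] using h

theorem untwist_triple (he : T.IsLeftUnit e) (x y z : U) :
    (untwist he).triple x y z = T.triple x (T.twist e y) z := rfl

theorem isLeftUnit_untwist (he : T.IsLeftUnit e) : (untwist he).IsLeftUnit e := by
  ext z
  simp [untwist_triple, he.twist_unit, he.unit_apply]

/-- As τe = e, the operator R is unchanged, while C becomes Cτ. This is C² = 1 on H and -C²/3 = -3
on S, hence 3 - 2R. -/
theorem untwist_conj (he : T.IsLeftUnit e) (x : U) :
    (untwist he).triple e x e = (3 : F) • x - (2 : F) • (untwist he).triple x e e := by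
  rw [untwist_triple, untwist_triple, he.twist_unit, ← he.twist_conj]
  refine smul_cancel (F := F) (NeZero.ne 3) ?_
  rw [three_smul_twist]
  simp only [he.conj_conj, ← he.conj_right]
  simp only [he.conj_conj, he.right_right, map_sub, map_smul, LinearMap.sub_apply,
    LinearMap.smul_apply]
  module

end LeftUnit

end KantorTripleSystem

/-! ### The product and the involution attached to a normalized unit. -/

namespace KantorTripleSystem

variable {F U : Type*} [Field F] [AddCommGroup U] [Module F U] (T : KantorTripleSystem F U)

/-- A left unit `e` with `exe = 3x - 2 xee`. -/
structure IsNormalizedUnit (e : U) : Prop where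
  isLeftUnit : T.IsLeftUnit e
  conj : ∀ x, T.triple e x e = (3 : F) • x - (2 : F) • T.triple x e e

/-- The involution `x ↦ 2x - xee`. -/
def bar (e : U) : Module.End F U := (2 : F) • LinearMap.id - (T.triple.flip e).flip e

theorem bar_apply (e x : U) : T.bar e x = (2 : F) • x - T.triple x e e := rfl

/-- The product `(1/2) (3 xez - (xee)ez + xze - ezx)`. -/
def mul (e : U) : U →ₗ[F] U →ₗ[F] U :=
  (2 : F)⁻¹ • ((3 : F) • T.triple.flip e - (T.triple.flip e).comp ((T.triple.flip e).flip e) +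
    LinearMap.mk₂ F (fun x z => T.K x e z) (by intros; simp [K_add]) (by intros; simp [K_smul])
      (by intros; simp only [map_add]) (by intros; simp only [map_smul]))

section NormalizedUnit

variable {T} {e : U} {h k s t : U}

theorem two_smul_mul [NeZero (2 : F)] (e x z : U) : (2 : F) • T.mul e x z =
    (3 : F) • T.triple x e z - T.triple (T.triple x e e) e z + T.triple x z e - T.triple e z x := by
  simp [mul, smul_smul, NeZero.ne (2 : F)]; abel

theorem bar_sym (hh : T.triple h e e = h) : T.bar e h = h := by
  rw [bar_apply, hh]; module

theorem bar_skew (hs : T.triple s e e = (3 : F) • s) : T.bar e s = -s := by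
  rw [bar_apply, hs]; module

theorem two_smul_mul_skew [NeZero (2 : F)] (hs : T.triple s e e = (3 : F) • s) (z : U) :
    (2 : F) • T.mul e s z = T.K s e z := by
  rw [two_smul_mul, hs, map_smul, LinearMap.smul_apply, LinearMap.smul_apply, K_apply]; module

variable [NeZero (2 : F)]

theorem IsLeftUnit.mul_sym (he : T.IsLeftUnit e) (hh : T.triple h e e = h) (z : U) :
    T.mul e h z = T.triple h e z := by
  refine smul_cancel (F := F) (NeZero.ne 2) ?_
  rw [two_smul_mul, hh, he.K_sym hh]; module

theorem IsLeftUnit.unit_mul (he : T.IsLeftUnit e) (z : U) : T.mul e e z = z := by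
  rw [he.mul_sym (he.unit_apply e), he.unit_apply]

theorem IsLeftUnit.mul_unit (he : T.IsLeftUnit e) (x : U) : T.mul e x e = x := by
  refine smul_cancel (F := F) (NeZero.ne 2) ?_
  rw [two_smul_mul, he.right_right, he.unit_apply]; module

theorem IsLeftUnit.bar_bar (he : T.IsLeftUnit e) (x : U) : T.bar e (T.bar e x) = x := by
  rw [bar_apply, bar_apply, map_sub, map_smul]
  simp only [LinearMap.sub_apply, LinearMap.smul_apply, he.right_right]
  module

theorem eq_of_bar_eq {x : U} (hx : T.bar e x = x) :
    T.triple x e e = x := by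
  rw [bar_apply] at hx
  linear_combination (norm := module) -hx

theorem bar_eq_neg {x : U} (hx : T.bar e x = -x) : T.triple x e e = (3 : F) • x := by
  rw [bar_apply] at hx
  linear_combination (norm := module) -hx

/-- For w = K(u,v)e, `kantor_unit` at e reads (R - 1)w = 2w. -/
theorem IsLeftUnit.K_unit_skew (he : T.IsLeftUnit e) (u v : U) :
    T.triple (T.K u v e) e e = (3 : F) • T.K u v e := by
  have h := he.kantor_unit u v e
  rw [K_apply, he.unit_apply] at h
  linear_combination (norm := module) h

/-- `K(u,v)` is left multiplication by `K(u,v)e`. -/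
theorem IsLeftUnit.K_eq_mul (he : T.IsLeftUnit e) (u v z : U) :
    T.K u v z = T.mul e (T.K u v e) z := by
  refine smul_cancel (F := F) (NeZero.ne 2) ?_
  rw [two_smul_mul_skew (he.K_unit_skew u v), he.kantor_unit]

/-- `K(u,v)K(x,y) = L(K(u,v)x, y) - L(K(u,v)y, x)`. -/
theorem K_K (u v x y z : U) :
    T.K u v (T.K x y z) = T.triple (T.K u v x) y z - T.triple (T.K u v y) x z := by
  -- Subtracting the two instances cancels the terms zx(K(u,v)y) and zy(K(u,v)x).
  have h1 := T.kantor u v x z y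
  have h2 := T.kantor u v y z x
  simp only [K_apply, map_sub, LinearMap.sub_apply] at h1 h2 ⊢
  linear_combination (norm := module) h2 - h1

namespace IsNormalizedUnit

theorem conj_sym (he : T.IsNormalizedUnit e) (hh : T.triple h e e = h) :
    T.triple e h e = h := by
  rw [he.conj, hh]; module

theorem conj_skew (he : T.IsNormalizedUnit e) (hs : T.triple s e e = (3 : F) • s) :
    T.triple e s e = -(3 : F) • s := by
  rw [he.conj, hs]; module

theorem skew_mul_sym (he : T.IsNormalizedUnit e) (hs : T.triple s e e = (3 : F) • s)
    (hh : T.triple h e e = h) :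
    T.mul e s h = T.triple s e h - (2 : F) • T.triple h e s := by
  have h1 := he.isLeftUnit.K_skew_conj hs h
  rw [he.conj_sym hh, ← two_smul_mul_skew hs] at h1
  refine smul_cancel (F := F) (NeZero.ne 2) ?_
  linear_combination (norm := module) h1

theorem triple_sym (he : T.IsNormalizedUnit e) (hh : T.triple h e e = h) (x z : U) :
    T.triple x h z = T.triple (T.triple h e x) e z -
      (T.triple h e (T.triple x e z) - T.triple x e (T.triple h e z)) := by
  rw [← triple_conj, he.conj_sym hh]

theorem triple_skew (he : T.IsNormalizedUnit e) (hs : T.triple s e e = (3 : F) • s) (x z : U) :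
    -(3 : F) • T.triple x s z = T.triple (T.triple s e x) e z -
      (T.triple s e (T.triple x e z) - T.triple x e (T.triple s e z)) := by
  rw [← triple_conj, he.conj_skew hs, map_smul, LinearMap.smul_apply]

/-- This is `K_K` for K(s,e)K(t,e), where K(s,e) and K(t,e) are twice the left multiplications by s
and t and K(s,e)e = 2s. -/
theorem triple_skew_skew (he : T.IsNormalizedUnit e) (hs : T.triple s e e = (3 : F) • s)
    (ht : T.triple t e e = (3 : F) • t) (z : U) :
    T.triple s t z = T.triple (T.mul e s t) e z - (2 : F) • T.mul e s (T.mul e t z) := by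
  have h1 := K_K (T := T) s e t e z
  rw [← two_smul_mul_skew hs, ← two_smul_mul_skew hs, ← two_smul_mul_skew hs,
    ← two_smul_mul_skew ht, he.isLeftUnit.mul_unit] at h1
  simp only [map_smul, LinearMap.smul_apply] at h1
  refine smul_cancel (F := F) (NeZero.ne 2) ?_
  linear_combination (norm := module) h1

/-- Left multiplication by `s*h + h*s` is the anticommutator of left multiplications. -/
theorem skew_sym_anticomm (he : T.IsNormalizedUnit e) (hs : T.triple s e e = (3 : F) • s)
    (hh : T.triple h e e = h) (z : U) :
    T.mul e s (T.mul e h z) + T.mul e h (T.mul e s z) =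
      T.mul e (T.mul e s h + T.mul e h s) z := by
  have hu := he.isLeftUnit
  -- Here K(s,h)e = seh - hes is exactly sh + hs, so K(s,h) is left multiplication by sh + hs. On
  -- the right side L(e,h) and L(h,e) are both left multiplication by h.
  have h1 := hu.K_skew hs h z
  have h2 := hu.triple_unit_conj h z
  rw [he.conj_sym hh, hh] at h2
  rw [hu.K_eq_mul, h2, ← two_smul_mul_skew hs, ← two_smul_mul_skew hs, K_apply] at h1
  rw [he.skew_mul_sym hs hh, hu.mul_sym hh, hu.mul_sym hh, hu.mul_sym hh]
  refine smul_cancel (F := F) (NeZero.ne 2) ?_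
  simp only [map_add, map_sub, map_smul, LinearMap.add_apply, LinearMap.sub_apply,
    LinearMap.smul_apply] at h1 ⊢
  linear_combination (norm := module) -h1

variable [NeZero (3 : F)]

theorem skew_mul_skew (he : T.IsNormalizedUnit e) (hs : T.triple s e e = (3 : F) • s)
    (ht : T.triple t e e = (3 : F) • t) :
    (3 : F) • T.mul e s t = (2 : F) • T.triple t e s - T.triple s e t := by
  have h1 := he.isLeftUnit.K_skew_conj hs t
  rw [he.conj_skew ht, ← two_smul_mul_skew hs] at h1
  simp only [map_smul] at h1
  refine smul_cancel (F := F) (NeZero.ne 2) ?_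
  linear_combination (norm := module) -h1

/-- `L(e, 2y - yee) = L(y,e)`. -/
theorem triple_unit_bar (he : T.IsNormalizedUnit e) (y z : U) :
    T.triple e (T.bar e y) z = T.triple y e z := by
  -- The argument (4 - R)y is chosen so that R(4 - R)y = 3y, while C = 3 - 2R sends it to 3(2 - R)y,
  -- three times the conjugate of y.
  have h1 := he.isLeftUnit.triple_unit_conj ((4 : F) • y - T.triple y e e) z
  rw [he.conj] at h1
  simp only [map_sub, map_smul, LinearMap.sub_apply, LinearMap.smul_apply,
    he.isLeftUnit.right_right] at h1
  refine smul_cancel (F := F) (NeZero.ne 3) ?_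
  simp only [bar_apply, map_sub, map_smul, LinearMap.sub_apply, LinearMap.smul_apply]
  linear_combination (norm := module) h1

theorem bar_sym_mul_sym (he : T.IsNormalizedUnit e) (hh : T.triple h e e = h)
    (hk : T.triple k e e = k) : T.bar e (T.mul e h k) = T.mul e k h := by
  rw [bar_apply, he.isLeftUnit.mul_sym hh, he.isLeftUnit.mul_sym hk,
    he.isLeftUnit.right_sym_sym hh hk]
  module

theorem bar_sym_mul_skew (he : T.IsNormalizedUnit e) (hh : T.triple h e e = h)
    (hs : T.triple s e e = (3 : F) • s) : T.bar e (T.mul e h s) = -T.mul e s h := by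
  rw [bar_apply, he.isLeftUnit.mul_sym hh, he.skew_mul_sym hs hh,
    he.isLeftUnit.right_sym_skew hh hs]
  module

theorem bar_skew_mul_sym (he : T.IsNormalizedUnit e) (hh : T.triple h e e = h)
    (hs : T.triple s e e = (3 : F) • s) : T.bar e (T.mul e s h) = -T.mul e h s := by
  rw [← neg_neg (T.mul e s h), ← he.bar_sym_mul_skew hh hs, map_neg, he.isLeftUnit.bar_bar]

theorem bar_skew_mul_skew (he : T.IsNormalizedUnit e) (hs : T.triple s e e = (3 : F) • s)
    (ht : T.triple t e e = (3 : F) • t) : T.bar e (T.mul e s t) = T.mul e t s := by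
  have h1 := he.isLeftUnit.right_skew_skew hs ht
  have h2 := he.isLeftUnit.right_skew_skew ht hs
  refine smul_cancel (F := F) (NeZero.ne 3) ?_
  rw [← map_smul, he.skew_mul_skew hs ht, he.skew_mul_skew ht hs]
  simp only [bar_apply, map_sub, map_smul, LinearMap.sub_apply, LinearMap.smul_apply, h1, h2]
  module

theorem bar_mul (he : T.IsNormalizedUnit e) (x y : U) :
    T.bar e (T.mul e x y) = T.mul e (T.bar e y) (T.bar e x) := by
  obtain ⟨h, s, hh, hs, rfl⟩ := exists_sym_add_skew he.isLeftUnit x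
  obtain ⟨k, t, hk, ht, rfl⟩ := exists_sym_add_skew he.isLeftUnit y
  simp only [map_add, LinearMap.add_apply, bar_sym hh, bar_sym hk, bar_skew hs, bar_skew ht,
    he.bar_sym_mul_sym hh hk, he.bar_sym_mul_skew hh ht, he.bar_skew_mul_sym hk hs,
    he.bar_skew_mul_skew hs ht, map_neg, LinearMap.neg_apply]
  abel

/-- The right side is V_{x,1}z, so this is the case y = 1 of the final identification with V_{x,y}z.
-/
theorem triple_unit_eq (he : T.IsNormalizedUnit e) (x z : U) :
    T.triple x e z = T.mul e x z + T.mul e z x - T.mul e z (T.bar e x) := by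
  obtain ⟨h, s, hh, hs, rfl⟩ := exists_sym_add_skew he.isLeftUnit x
  obtain ⟨k, t, hk, ht, rfl⟩ := exists_sym_add_skew he.isLeftUnit z
  have h1 := he.skew_mul_sym hs hk
  rw [← he.isLeftUnit.mul_sym hk] at h1
  have h2 : T.triple s e t = T.mul e s t + (2 : F) • T.mul e t s := by
    refine smul_cancel (F := F) (NeZero.ne 3) ?_
    have h3 := he.skew_mul_skew hs ht
    have h4 := he.skew_mul_skew ht hs
    linear_combination (norm := module) -h3 - (2 : F) • h4
  simp only [map_add, LinearMap.add_apply, bar_sym hh, bar_skew hs, map_neg, h2,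
    ← he.isLeftUnit.mul_sym hh]
  linear_combination (norm := module) -h1

theorem K_unit (he : T.IsNormalizedUnit e) (x z : U) :
    T.K x z e = T.mul e x (T.bar e z) - T.mul e z (T.bar e x) := by
  rw [K_apply, he.triple_unit_eq, he.triple_unit_eq]
  abel

theorem triple_swap (he : T.IsNormalizedUnit e) (x y z : U) : T.triple x y z =
    T.triple z y x + T.mul e (T.mul e x (T.bar e z) - T.mul e z (T.bar e x)) y := by
  rw [← he.K_unit, ← he.isLeftUnit.K_eq_mul, K_apply]; abel

theorem triple_sym_mul (he : T.IsNormalizedUnit e) (hh : T.triple h e e = h) (x z : U) :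
    T.triple x h z = T.triple (T.mul e h x) e z -
      (T.mul e h (T.triple x e z) - T.triple x e (T.mul e h z)) := by
  simp only [he.isLeftUnit.mul_sym hh]
  exact he.triple_sym hh x z

/-- L(s,t) + L(t,s) is computed twice. By `triple_skew_skew` it is L(st + ts, e) minus twice the
anticommutator of the left multiplications. By `triple_skew` the commutators cancel and it is -L(st
+ ts, e). As st + ts is symmetric, L(st + ts, e) is left multiplication by it. -/
theorem skew_skew_anticomm (he : T.IsNormalizedUnit e) (hs : T.triple s e e = (3 : F) • s)
    (ht : T.triple t e e = (3 : F) • t) (z : U) :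
    T.mul e s (T.mul e t z) + T.mul e t (T.mul e s z) =
      T.mul e (T.mul e s t + T.mul e t s) z := by
  have h0 : T.triple (T.mul e s t + T.mul e t s) e e = T.mul e s t + T.mul e t s := by
    refine eq_of_bar_eq ?_
    rw [map_add, he.bar_skew_mul_skew hs ht, he.bar_skew_mul_skew ht hs, add_comm]
  have h1 := he.triple_skew_skew hs ht z
  have h2 := he.triple_skew_skew ht hs z
  have h3 := he.triple_skew hs t z
  have h4 := he.triple_skew ht s z
  have h5 := congrArg (fun x => T.triple x e z) (he.skew_mul_skew hs ht)
  have h6 := congrArg (fun x => T.triple x e z) (he.skew_mul_skew ht hs)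
  rw [he.isLeftUnit.mul_sym h0]
  refine smul_cancel (F := F) (c := 2 * 3) (mul_ne_zero (NeZero.ne 2) (NeZero.ne 3)) ?_
  simp only [map_add, map_sub, map_smul, LinearMap.add_apply, LinearMap.sub_apply,
    LinearMap.smul_apply] at h5 h6 ⊢
  linear_combination (norm := module) (3 : F) • h1 + (3 : F) • h2 + h3 + h4 - h5 - h6

/-- Skew-symmetric elements associate alternatingly in the first two places. -/
theorem skew_anticomm (he : T.IsNormalizedUnit e) (hs : T.bar e s = -s) (y z : U) :
    T.mul e s (T.mul e y z) + T.mul e y (T.mul e s z) =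
      T.mul e (T.mul e s y + T.mul e y s) z := by
  have hs' := bar_eq_neg hs
  obtain ⟨k, t, hk, ht, rfl⟩ := exists_sym_add_skew he.isLeftUnit y
  have h1 := he.skew_sym_anticomm hs' hk z
  have h2 := he.skew_skew_anticomm hs' ht z
  simp only [map_add, LinearMap.add_apply] at h1 h2 ⊢
  linear_combination (norm := module) h1 + h2

/-- `triple_unit_triple` gives L(h,s) = L(e,hs) - [L(h,e),L(s,e)]. Since hs is minus the conjugate
of sh, L(e,hs) = -L(sh,e) by `triple_unit_bar`, and `triple_sym` replaces the commutator by L(hs,e)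
- L(s,h). -/
theorem triple_sym_skew (he : T.IsNormalizedUnit e) (hh : T.triple h e e = h)
    (hs : T.triple s e e = (3 : F) • s) (z : U) :
    T.triple h s z = T.triple s h z - T.triple (T.mul e s h + T.mul e h s) e z := by
  have h1 := he.isLeftUnit.triple_unit_triple s h z
  have h2 := he.triple_unit_bar (T.mul e s h) z
  have h3 := he.triple_sym hh s z
  have h4 := he.isLeftUnit.triple_unit_conj h s
  rw [he.conj_sym hh, hh] at h4
  rw [he.conj_skew hs, hs, hh] at h1
  rw [he.bar_skew_mul_sym hh hs, he.isLeftUnit.mul_sym hh] at h2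
  refine smul_cancel (F := F) (NeZero.ne 3) ?_
  simp only [map_add, map_sub, map_smul, map_neg, LinearMap.add_apply, LinearMap.sub_apply,
    LinearMap.smul_apply, LinearMap.neg_apply, h4, he.isLeftUnit.mul_sym hh] at h1 h2 h3 ⊢
  linear_combination (norm := module) h1 - (3 : F) • h2 - (3 : F) • h3

end IsNormalizedUnit

end NormalizedUnit

end KantorTripleSystem

/-! ### The structurable algebra of a normalized unit, and xyz = V_{x,y}z. -/

namespace KantorTripleSystem

variable {F U : Type*} [Field F] [AddCommGroup U] [Module F U] {T : KantorTripleSystem F U}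

/-- The algebra on `U` with the product `mul e` and the involution `bar e`. -/
def UnitalAlg {e : U} (_ : T.IsNormalizedUnit e) : Type _ := U

namespace UnitalAlg

variable {e : U} {he : T.IsNormalizedUnit e}

instance instAddCommGroup : AddCommGroup (UnitalAlg he) := inferInstanceAs (AddCommGroup U)
instance : Module F (UnitalAlg he) := inferInstanceAs (Module F U)

/-- The identity map from `U` to the algebra on `U`. -/
def of (he : T.IsNormalizedUnit e) : U ≃ₗ[F] UnitalAlg he := LinearEquiv.refl F U

variable [NeZero (2 : F)]

noncomputable instance : NonAssocRing (UnitalAlg he) where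
  __ := instAddCommGroup (he := he)
  mul x y := T.mul e x y
  one := e
  left_distrib x y z := map_add (T.mul e x) y z
  right_distrib x y z := LinearMap.congr_fun (map_add (T.mul e) x y) z
  zero_mul x := LinearMap.congr_fun (map_zero (T.mul e)) x
  mul_zero x := map_zero (T.mul e x)
  one_mul x := he.isLeftUnit.unit_mul x
  mul_one x := he.isLeftUnit.mul_unit x

instance : SMulCommClass F (UnitalAlg he) (UnitalAlg he) where
  smul_comm c x y := ((T.mul e x).map_smul c y).symm

instance : IsScalarTower F (UnitalAlg he) (UnitalAlg he) where
  smul_assoc c x y := LinearMap.congr_fun ((T.mul e).map_smul c x) y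

variable [NeZero (3 : F)]

instance : StarRing (UnitalAlg he) where
  star x := T.bar e x
  star_involutive x := he.isLeftUnit.bar_bar x
  star_mul x y := he.bar_mul x y
  star_add x y := map_add (T.bar e) x y

theorem star_smul (c : F) (x : UnitalAlg he) : star (c • x) = c • star x :=
  (T.bar e).map_smul c x

/-- The triple product of `T` on the algebra. -/
def tri (x y z : UnitalAlg he) : UnitalAlg he := T.triple x y z

theorem tri_add (x x' y z : UnitalAlg he) : tri (x + x') y z = tri x y z + tri x' y z :=
  congrArg (fun f : U →ₗ[F] U →ₗ[F] U => f y z) (map_add T.triple x x')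
theorem tri_add' (x y y' z : UnitalAlg he) : tri x (y + y') z = tri x y z + tri x y' z :=
  LinearMap.congr_fun (map_add (T.triple x) y y') z
theorem tri_add'' (x y z z' : UnitalAlg he) : tri x y (z + z') = tri x y z + tri x y z' :=
  map_add (T.triple x y) z z'

theorem exists_star_add (x : UnitalAlg he) :
    ∃ h s : UnitalAlg he, star h = h ∧ star s = -s ∧ x = h + s := by
  obtain ⟨h, s, hh, hs, hx⟩ := exists_sym_add_skew he.isLeftUnit x
  exact ⟨h, s, bar_sym (T := T) hh, bar_skew (T := T) hs, hx⟩

theorem skew_anticomm {s : UnitalAlg he} (hs : star s = -s) (y z : UnitalAlg he) :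
    s * (y * z) + y * (s * z) = (s * y + y * s) * z :=
  he.skew_anticomm hs y z

theorem skew_anticomm_right {s : UnitalAlg he} (hs : star s = -s) (x y : UnitalAlg he) :
    (x * y) * s + (x * s) * y = x * (y * s + s * y) := by
  have h := congrArg star (skew_anticomm hs (star y) (star x))
  simp only [star_add, star_mul, star_star, hs, mul_neg, neg_mul, mul_add] at h ⊢
  linear_combination (norm := abel) -h

theorem tri_one (x z : UnitalAlg he) : tri x 1 z = x * z + z * x - z * star x :=
  he.triple_unit_eq x z

theorem tri_swap (x y z : UnitalAlg he) :
    tri x y z = tri z y x + (x * star z - z * star x) * y :=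
  he.triple_swap x y z

theorem tri_sym {h : UnitalAlg he} (hh : star h = h) (x z : UnitalAlg he) :
    tri x h z = tri (h * x) 1 z - (h * tri x 1 z - tri x 1 (h * z)) :=
  he.triple_sym_mul (eq_of_bar_eq (T := T) hh) x z

theorem tri_skew_skew {s t : UnitalAlg he} (hs : star s = -s) (ht : star t = -t)
    (z : UnitalAlg he) : tri s t z = tri (s * t) 1 z - (2 : F) • (s * (t * z)) :=
  he.triple_skew_skew (bar_eq_neg hs) (bar_eq_neg ht) z

theorem tri_sym_skew {h s : UnitalAlg he} (hh : star h = h) (hs : star s = -s)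
    (z : UnitalAlg he) : tri h s z = tri s h z - tri (s * h + h * s) 1 z :=
  he.triple_sym_skew (eq_of_bar_eq (T := T) hh) (bar_eq_neg hs) z

variable {h k l s t r : UnitalAlg he}

theorem tri_sym_sym_sym (hh : star h = h) (hk : star k = k) (hl : star l = l) :
    tri k h l = opV F k h l := by
  -- On symmetric elements the defect D is symmetric in its outer arguments and skew in its first
  -- two. The two transpositions are conjugate in S₃, so D = -D.
  let D : UnitalAlg he → UnitalAlg he → UnitalAlg he → UnitalAlg he :=
    fun k h l => tri k h l - opV F k h l
  have h1 : ∀ {k h l : UnitalAlg he}, star k = k → star h = h → star l = l →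
      D k h l = D l h k := by
    intro k h l hk hh hl
    simp only [D, tri_swap k h l, opV_apply, hk, hh, hl, sub_mul]
    abel
  have h2 : ∀ {k h l : UnitalAlg he}, star k = k → star h = h → star l = l →
      D k h l = -D h k l := by
    intro k h l hk hh hl
    simp only [D, tri_sym hh, tri_sym hk, tri_one, opV_apply, hk, hh, hl, star_mul, sub_mul, mul_sub,
      add_mul, mul_add]
    abel
  have h3 : D k h l = -D k h l := by
    calc D k h l = -D h k l := h2 hk hh hl
      _ = -D l k h := by rw [h1 hh hk hl]
      _ = D k l h := by rw [h2 hl hk hh, neg_neg]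
      _ = D h l k := h1 hk hl hh
      _ = -D l h k := h2 hh hl hk
      _ = -D k h l := by rw [h1 hl hh hk]
  have h4 : D k h l = 0 := by
    refine smul_cancel (F := F) (NeZero.ne 2) ?_
    rw [two_smul, smul_zero]
    nth_rewrite 1 [h3]
    exact neg_add_cancel _
  exact sub_eq_zero.mp h4

/-- In this and the following mixed cases the triple product is reduced, directly or through an
earlier case, to products with middle entry 1. The difference from V_{x,y}z then consists of
associator relations with a skew entry, supplied by `skew_anticomm` and its mirror image. -/
theorem tri_sym_sym_skew (hh : star h = h) (hk : star k = k) (hs : star s = -s) :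
    tri k h s = opV F k h s := by
  have e1 := skew_anticomm hs h k
  have e2 := skew_anticomm hs k h
  have e3 := skew_anticomm_right hs h k
  have e4 := skew_anticomm_right hs k h
  simp only [tri_sym hh, tri_one, opV_apply, hh, hk, hs, star_mul, sub_mul, mul_sub,
    add_mul, mul_add, neg_mul, mul_neg] at e1 e2 e3 e4 ⊢
  linear_combination (norm := abel) e3 - e4 + e1 - e2

theorem tri_skew_sym_sym (hh : star h = h) (hk : star k = k) (hs : star s = -s) :
    tri s h k = opV F s h k := by
  rw [tri_swap, tri_sym_sym_skew hh hk hs]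
  simp only [opV_apply, hh, hk, hs, sub_mul, neg_mul, mul_neg]
  abel

theorem tri_skew_sym_skew (hh : star h = h) (hs : star s = -s) (ht : star t = -t) :
    tri s h t = opV F s h t := by
  have e1 := skew_anticomm hs h t
  have e3 := skew_anticomm_right ht h s
  have e4 := skew_anticomm_right hs t h
  simp only [tri_sym hh, tri_one, opV_apply, hh, ht, hs, star_mul, sub_mul, mul_sub,
    add_mul, mul_add, neg_mul, mul_neg] at e1 e3 e4 ⊢
  linear_combination (norm := abel) (2 : ℤ) • e3 + e1 - e4

theorem tri_skew_skew_apply (hs : star s = -s) (ht : star t = -t) (z : UnitalAlg he) :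
    tri s t z = opV F s t z := by
  have e2 := skew_anticomm hs z t
  have e3 := skew_anticomm_right ht z s
  have e4 := skew_anticomm_right ht s z
  rw [tri_skew_skew hs ht, two_smul]
  simp only [tri_one, opV_apply, ht, hs, star_mul, sub_mul, mul_sub,
    add_mul, mul_add, neg_mul, mul_neg, neg_neg] at e2 e3 e4 ⊢
  linear_combination (norm := abel) e3 + (2 : ℤ) • e2 + (2 : ℤ) • e4

theorem tri_sym_skew_skew (hh : star h = h) (hs : star s = -s) (ht : star t = -t) :
    tri h s t = opV F h s t := by
  rw [tri_swap, tri_skew_skew_apply ht hs]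
  simp only [opV_apply, hh, ht, hs, sub_mul, neg_mul, mul_neg]
  abel

theorem tri_sym_skew_sym (hh : star h = h) (hs : star s = -s) (hk : star k = k) :
    tri h s k = opV F h s k := by
  have e1 := skew_anticomm_right hs k h
  rw [tri_sym_skew hh hs, tri_skew_sym_sym hh hk hs]
  simp only [tri_one, opV_apply, hh, hk, hs, star_add, star_mul, sub_mul, mul_sub,
    add_mul, mul_add, neg_mul, mul_neg, neg_neg] at e1 ⊢
  linear_combination (norm := abel) (2 : ℤ) • e1

theorem opV_add_left (x x' y z : UnitalAlg he) :
    opV F (x + x') y z = opV F x y z + opV F x' y z := by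
  simp only [opV_apply, star_add, add_mul, mul_add]; abel

theorem opV_add_right (x y y' z : UnitalAlg he) :
    opV F x (y + y') z = opV F x y z + opV F x y' z := by
  simp only [opV_apply, star_add, add_mul, mul_add]; abel

/-- The triple product of `T` is `V_{x,y} z`. -/
theorem tri_eq_opV (x y z : UnitalAlg he) : tri x y z = opV F x y z := by
  obtain ⟨h, s, hh, hs, rfl⟩ := exists_star_add x
  obtain ⟨k, t, hk, ht, rfl⟩ := exists_star_add y
  obtain ⟨l, r, hl, hr, rfl⟩ := exists_star_add z
  simp only [tri_add, tri_add', tri_add'', opV_add_left, opV_add_right, map_add,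
    tri_sym_sym_sym hk hh hl, tri_sym_sym_skew hk hh hr, tri_skew_sym_sym hk hl hs,
    tri_skew_sym_skew hk hs hr, tri_skew_skew_apply hs ht, tri_sym_skew_skew hh ht hr,
    tri_sym_skew_sym hh ht hl]

/-- The associator law is `skew_anticomm` for the skew element x - x̄. The commutator identity is
the first Kantor axiom read through `tri_eq_opV`. -/
instance : IsStructurable F (UnitalAlg he) where
  star_smul := star_smul
  associator_sub_star x y z := by
    have h := skew_anticomm (s := x - star x) (by simp) y z
    have h' : star x - x = -(x - star x) := by abel
    rw [h', associator, associator]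
    simp only [mul_neg, neg_mul, add_mul, mul_add] at h ⊢
    linear_combination (norm := abel) -h
  opV_comm u v x y := by
    ext z
    have h := T.triple_triple u v x y z
    change tri u v (tri x y z) - tri x y (tri u v z) =
      tri (tri u v x) y z - tri x (tri v u y) z at h
    simp only [tri_eq_opV] at h
    exact h

theorem triple_apply (x y z : UnitalAlg he) :
    (Structurable.triple F (UnitalAlg he)).triple x y z = T.triple x y z :=
  (tri_eq_opV x y z).symm

end UnitalAlg

end KantorTripleSystem

/-! ### Graded isomorphisms of 𝔤(U) induced by pairs of maps. -/

namespace KantorTripleSystem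

attribute [local instance] LieRing.ofAssociativeRing

section Grading

variable {F U : Type*} [Field F] [AddCommGroup U] [Module F U] (T : KantorTripleSystem F U)

theorem grading_zero : T.grading 0 =
    T.component (Submodule.span F {M | ∃ a b, M = !![T.L a b, 0; 0, -T.L b a]}) ⊥ := rfl
theorem grading_one : T.grading 1 = T.component ⊥ (LinearMap.ker (LinearMap.proj 1)) := rfl
theorem grading_neg_one :
    T.grading (-1) = T.component ⊥ (LinearMap.ker (LinearMap.proj 0)) := rfl
theorem grading_two : T.grading 2 =
    T.component (Submodule.span F {M | ∃ a b, M = !![0, T.K a b; 0, 0]}) ⊥ := rfl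
theorem grading_neg_two : T.grading (-2) =
    T.component (Submodule.span F {M | ∃ a b, M = !![0, 0; T.K a b, 0]}) ⊥ := rfl
theorem grading_eq_bot {i : ℤ} (h0 : i ≠ 0) (h1 : i ≠ 1) (h2 : i ≠ -1) (h3 : i ≠ 2)
    (h4 : i ≠ -2) : T.grading i = ⊥ := by
  simp [grading, h0, h1, h2, h3, h4]

theorem mem_component {N : Submodule F (Matrix (Fin 2) (Fin 2) (Module.End F U))}
    {W : Submodule F (Fin 2 → U)} {P : T.LieAlg} :
    P ∈ T.component N W ↔ P.mat ∈ N ∧ P.col ∈ W := Iff.rfl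

end Grading

section Congr

variable {F U U' : Type*} [Field F] [AddCommGroup U] [Module F U] [AddCommGroup U'] [Module F U']

/-- Two linear equivalences, acting on the first and the second entry of a column. -/
def colEquiv (φ ψ : U ≃ₗ[F] U') : Fin 2 → (U ≃ₗ[F] U') := ![φ, ψ]

/-- Conjugation of a matrix of operators by the diagonal matrix with entries `φ`, `ψ`. -/
def matMap (φ ψ : U ≃ₗ[F] U') :
    Matrix (Fin 2) (Fin 2) (Module.End F U) →ₗ[F] Matrix (Fin 2) (Fin 2) (Module.End F U') where
  toFun M := Matrix.of fun i j =>
    (colEquiv φ ψ i).toLinearMap ∘ₗ M i j ∘ₗ (colEquiv φ ψ j).symm.toLinearMap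
  map_add' M N := by ext; simp
  map_smul' c M := by ext; simp

theorem matMap_apply (φ ψ : U ≃ₗ[F] U') (M : Matrix (Fin 2) (Fin 2) (Module.End F U))
    (i j : Fin 2) (z : U') :
    matMap φ ψ M i j z = colEquiv φ ψ i (M i j ((colEquiv φ ψ j).symm z)) := rfl

theorem matMap_lie (φ ψ : U ≃ₗ[F] U') (M N : Matrix (Fin 2) (Fin 2) (Module.End F U)) :
    matMap φ ψ ⁅M, N⁆ = ⁅matMap φ ψ M, matMap φ ψ N⁆ := by
  ext i j z
  simp [Ring.lie_def, Matrix.mul_apply, matMap_apply, LinearMap.sum_apply]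

theorem act_matMap (φ ψ : U ≃ₗ[F] U') (M : Matrix (Fin 2) (Fin 2) (Module.End F U))
    (X : Fin 2 → U) :
    act (matMap φ ψ M) (fun i => colEquiv φ ψ i (X i)) = fun i => colEquiv φ ψ i (act M X i) := by
  ext i
  simp [act, matMap_apply]

theorem matMap_symm_matMap (φ ψ : U ≃ₗ[F] U') (M : Matrix (Fin 2) (Fin 2) (Module.End F U)) :
    matMap φ.symm ψ.symm (matMap φ ψ M) = M := by
  ext i j z
  fin_cases i <;> fin_cases j <;> simp [matMap_apply, colEquiv]

/-- A pair of linear equivalences compatible with the triple products. -/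
structure IsPairEquiv (T : KantorTripleSystem F U) (T' : KantorTripleSystem F U')
    (φ ψ : U ≃ₗ[F] U') : Prop where
  left : ∀ x y z, φ (T.triple x y z) = T'.triple (φ x) (ψ y) (φ z)
  right : ∀ x y z, ψ (T.triple x y z) = T'.triple (ψ x) (φ y) (ψ z)

variable {T : KantorTripleSystem F U} {T' : KantorTripleSystem F U'} {φ ψ : U ≃ₗ[F] U'}

namespace IsPairEquiv

theorem symm (h : IsPairEquiv T T' φ ψ) : IsPairEquiv T' T φ.symm ψ.symm where
  left x y z := φ.injective (by simp [h.left])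
  right x y z := ψ.injective (by simp [h.right])

/-- The middle entry of a product transforms by the other map of the pair. This is what gives
φK(a,b)ψ⁻¹ = K'(φa,φb) off the diagonal and φL(a,b)φ⁻¹ = L'(φa,ψb) on it. -/
theorem matMap_colBracket (h : IsPairEquiv T T' φ ψ) (X Y : Fin 2 → U) :
    matMap φ ψ (T.colBracket X Y) = T'.colBracket (fun i => colEquiv φ ψ i (X i))
      (fun i => colEquiv φ ψ i (Y i)) := by
  ext i j z
  fin_cases i <;> fin_cases j <;> simp [matMap_apply, colEquiv, colBracket, h.left, h.right]

theorem matMap_mem (h : IsPairEquiv T T' φ ψ) {M : Matrix (Fin 2) (Fin 2) (Module.End F U)}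
    (hM : M ∈ T.evenSpan) : matMap φ ψ M ∈ T'.evenSpan := by
  have : T.evenSpan ≤ T'.evenSpan.comap (matMap φ ψ) := by
    refine Submodule.span_le.2 ?_
    rintro _ ⟨a, b, c, d, e, f, rfl⟩
    rw [genMatrix_eq]
    simp only [SetLike.mem_coe, Submodule.mem_comap, map_add, h.matMap_colBracket]
    have := T'.colBracket_mem
    exact add_mem (add_mem (this _ _) (this _ _)) (this _ _)
  exact this hM

/-- The map of Lie algebras induced by a pair of linear equivalences compatible with the triple
products. -/
noncomputable def lieMap (h : IsPairEquiv T T' φ ψ) (P : T.LieAlg) : T'.LieAlg :=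
  (⟨matMap φ ψ P.mat, h.matMap_mem P.1.2⟩, fun i => colEquiv φ ψ i (P.col i))

theorem mat_lieMap (h : IsPairEquiv T T' φ ψ) (P : T.LieAlg) :
    (h.lieMap P).mat = matMap φ ψ P.mat := rfl
theorem col_lieMap (h : IsPairEquiv T T' φ ψ) (P : T.LieAlg) :
    (h.lieMap P).col = fun i => colEquiv φ ψ i (P.col i) := rfl

/-- The homomorphism of Lie algebras induced by a pair of linear equivalences compatible with the
triple products. -/
noncomputable def lieHom (h : IsPairEquiv T T' φ ψ) : T.LieAlg →ₗ⁅F⁆ T'.LieAlg where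
  toFun := h.lieMap
  map_add' P Q := by
    ext i
    · rw [mat_add, mat_lieMap, mat_add, map_add]; rfl
    · rw [col_add, col_lieMap, col_add]; exact map_add _ _ _
  map_smul' c P := by
    ext i
    · rw [mat_smul, mat_lieMap, mat_smul, map_smul]; rfl
    · rw [col_smul, col_lieMap, col_smul]; exact map_smul _ _ _
  map_lie' {P Q} := by
    refine LieAlg.ext _ ?_ ?_
    · rw [mat_lie, mat_lieMap, mat_lie, map_add, matMap_lie, h.matMap_colBracket]
      rfl
    · rw [col_lie, col_lieMap, col_lie, mat_lieMap, mat_lieMap, col_lieMap, col_lieMap,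
        act_matMap, act_matMap]
      ext i
      simp

theorem mat_lieHom (h : IsPairEquiv T T' φ ψ) (P : T.LieAlg) :
    (h.lieHom P).mat = matMap φ ψ P.mat := rfl
theorem col_lieHom (h : IsPairEquiv T T' φ ψ) (P : T.LieAlg) :
    (h.lieHom P).col = fun i => colEquiv φ ψ i (P.col i) := rfl

theorem lieHom_symm_lieHom (h : IsPairEquiv T T' φ ψ) (P : T.LieAlg) :
    h.symm.lieHom (h.lieHom P) = P := by
  refine LieAlg.ext _ ?_ ?_
  · rw [mat_lieHom, mat_lieHom, matMap_symm_matMap]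
  · rw [col_lieHom, col_lieHom]
    ext i
    fin_cases i <;> simp [colEquiv]

/-- The isomorphism of Lie algebras induced by a pair of linear equivalences compatible with the
triple products. -/
noncomputable def lieEquiv (h : IsPairEquiv T T' φ ψ) : T.LieAlg ≃ₗ⁅F⁆ T'.LieAlg :=
  { h.lieHom with
    invFun := h.symm.lieHom
    left_inv := h.lieHom_symm_lieHom
    right_inv := h.symm.lieHom_symm_lieHom }

theorem matMap_mem_span {S : Set (Matrix (Fin 2) (Fin 2) (Module.End F U))}
    {S' : Set (Matrix (Fin 2) (Fin 2) (Module.End F U'))}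
    (hS : ∀ M ∈ S, matMap φ ψ M ∈ S') {M : Matrix (Fin 2) (Fin 2) (Module.End F U)}
    (hM : M ∈ Submodule.span F S) : matMap φ ψ M ∈ Submodule.span F S' :=
  (Submodule.span_le.2 fun N hN => Submodule.subset_span (hS N hN) :
    Submodule.span F S ≤ (Submodule.span F S').comap (matMap φ ψ)) hM

theorem lieHom_mem_grading (h : IsPairEquiv T T' φ ψ) {i : ℤ} {P : T.LieAlg}
    (hP : P ∈ T.grading i) : h.lieHom P ∈ T'.grading i := by
  have hcol : P.col = 0 → (h.lieHom P).col = 0 := by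
    intro h0
    rw [col_lieHom, h0]
    ext i
    simp
  by_cases h0 : i = 0
  · subst h0
    rw [grading_zero, mem_component] at hP ⊢
    refine ⟨matMap_mem_span ?_ hP.1, hcol hP.2⟩
    rintro _ ⟨a, b, rfl⟩
    refine ⟨φ a, ψ b, ?_⟩
    ext i j z
    fin_cases i <;> fin_cases j <;> simp [matMap_apply, colEquiv, h.left, h.right]
  by_cases h1 : i = 1
  · subst h1
    rw [grading_one, mem_component] at hP ⊢
    obtain ⟨hm, hc⟩ := hP
    rw [Submodule.mem_bot] at hm
    refine ⟨?_, ?_⟩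
    · rw [mat_lieHom, hm, map_zero]; exact zero_mem _
    · simp at hc
      simp [col_lieHom, hc]
  by_cases h2 : i = -1
  · subst h2
    rw [grading_neg_one, mem_component] at hP ⊢
    obtain ⟨hm, hc⟩ := hP
    rw [Submodule.mem_bot] at hm
    refine ⟨?_, ?_⟩
    · rw [mat_lieHom, hm, map_zero]; exact zero_mem _
    · simp at hc
      simp [col_lieHom, hc]
  by_cases h3 : i = 2
  · subst h3
    rw [grading_two, mem_component] at hP ⊢
    refine ⟨matMap_mem_span ?_ hP.1, hcol hP.2⟩
    rintro _ ⟨a, b, rfl⟩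
    refine ⟨φ a, φ b, ?_⟩
    ext i j z
    fin_cases i <;> fin_cases j <;> simp [matMap_apply, colEquiv, h.left, h.right]
  by_cases h4 : i = -2
  · subst h4
    rw [grading_neg_two, mem_component] at hP ⊢
    refine ⟨matMap_mem_span ?_ hP.1, hcol hP.2⟩
    rintro _ ⟨a, b, rfl⟩
    refine ⟨ψ a, ψ b, ?_⟩
    ext i j z
    fin_cases i <;> fin_cases j <;> simp [matMap_apply, colEquiv, h.left, h.right]
  rw [grading_eq_bot _ h0 h1 h2 h3 h4, Submodule.mem_bot] at hP
  rw [hP, map_zero]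
  exact zero_mem _

end IsPairEquiv

end Congr

end KantorTripleSystem

/-! ### 𝒦(A) is the Lie algebra of the triple system V_{x,y}z. -/

namespace AllisonAlg

open Structurable KantorTripleSystem

variable {F A : Type*} [Field F] [NonAssocRing A] [StarRing A] [Module F A]
  [SMulCommClass F A A] [IsScalarTower F A A] [IsStructurable F A] [NeZero (2 : F)] [NeZero (3 : F)]

/-- The operators K(a,b) are thus left multiplications by skew elements, which matches the
components of degree ±2 with S. -/
theorem K_triple (a b : A) :
    (Structurable.triple F A).K a b = LinearMap.mulLeft F (psi (F := F) a b : A) := by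
  ext z
  simp [Structurable.triple, psi, sub_mul]
  abel

/-- Every skew element is a value of ψ, since ψ(s/2, 1) = s/2 + s/2, so all of S is reached. -/
theorem mulLeft_skew_eq_K (s : skewPart F A) : LinearMap.mulLeft F (s : A) =
    (Structurable.triple F A).K ((2 : F)⁻¹ • (s : A)) 1 := by
  rw [K_triple]
  congr 1
  simp [psi, IsStructurable.star_smul, star_skew]
  rw [← two_smul F, smul_smul, mul_inv_cancel₀ (NeZero.ne (2 : F)), one_smul]

theorem L_triple (a b : A) : (Structurable.triple F A).L a b = opV F a b := rfl

theorem mem_grading {P : AllisonAlg F A} {i : ℤ} : P ∈ AllisonAlg.grading F A i ↔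
    (i ≠ -2 → P.t = 0) ∧ (i ≠ -1 → P.y = 0) ∧ (i ≠ 0 → P.op = 0) ∧
    (i ≠ 1 → P.x = 0) ∧ (i ≠ 2 → P.s = 0) := Iff.rfl

theorem toLieAlg_mem_grading {P : AllisonAlg F A} {i : ℤ} (hP : P ∈ AllisonAlg.grading F A i) :
    toLieAlg P ∈ (Structurable.triple F A).grading i := by
  obtain ⟨ht, hy, ho, hx, hs⟩ := mem_grading.1 hP
  have hcol : P.x = 0 → P.y = 0 → (toLieAlg P).col ∈ (⊥ : Submodule F (Fin 2 → A)) := by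
    intro hx hy
    rw [Submodule.mem_bot, col_toLieAlg, hx, hy]
    ext j; fin_cases j <;> rfl
  by_cases h0 : i = 0
  · subst h0
    rw [grading_zero, mem_component]
    refine ⟨?_, hcol (hx (by norm_num)) (hy (by norm_num))⟩
    rw [mat_toLieAlg, hs (by norm_num), ht (by norm_num)]
    have key : ∀ T ∈ instrl F A, (!![T, 0; 0, epsEnd T] : Matrix (Fin 2) (Fin 2) (Module.End F A)) ∈
        Submodule.span F {M | ∃ a b, M = !![(Structurable.triple F A).L a b, 0;
          0, -(Structurable.triple F A).L b a]} := by
      intro T hT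
      refine instrl_induction (p := fun T => (!![T, 0; 0, epsEnd T] :
        Matrix (Fin 2) (Fin 2) (Module.End F A)) ∈ _) ?_ ?_ ?_ ?_ hT
      · intro x y
        refine Submodule.subset_span ⟨x, y, ?_⟩
        rw [epsEnd_opV, L_triple, L_triple]
      · convert Submodule.zero_mem _ using 1
        ext i j z
        fin_cases i <;> fin_cases j <;> simp [epsEnd_zero]
      · intro S T hS hT
        convert add_mem hS hT using 1
        ext i j z
        fin_cases i <;> fin_cases j <;> simp [epsEnd_add]
      · intro c S hS
        convert Submodule.smul_mem _ c hS using 1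
        ext i j z
        fin_cases i <;> fin_cases j <;> simp [epsEnd_smul]
    convert key P.op.1 P.op.2 using 1
    ext i j z
    fin_cases i <;> fin_cases j <;> simp
  by_cases h1 : i = 1
  · subst h1
    rw [grading_one, mem_component, Submodule.mem_bot]
    rw [mat_toLieAlg, col_toLieAlg, hs (by norm_num), ht (by norm_num), ho (by norm_num),
      hy (by norm_num)]
    refine ⟨?_, by simp⟩
    ext i j z
    fin_cases i <;> fin_cases j <;> simp [epsEnd_zero]
  by_cases h2 : i = -1
  · subst h2
    rw [grading_neg_one, mem_component, Submodule.mem_bot]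
    rw [mat_toLieAlg, col_toLieAlg, hs (by norm_num), ht (by norm_num), ho (by norm_num),
      hx (by norm_num)]
    refine ⟨?_, by simp⟩
    ext i j z
    fin_cases i <;> fin_cases j <;> simp [epsEnd_zero]
  by_cases h3 : i = 2
  · subst h3
    rw [grading_two, mem_component]
    refine ⟨Submodule.subset_span ⟨(2 : F)⁻¹ • (P.s : A), 1, ?_⟩,
      hcol (hx (by norm_num)) (hy (by norm_num))⟩
    rw [mat_toLieAlg, ht (by norm_num), ho (by norm_num), mulLeft_skew_eq_K]
    ext i j z
    fin_cases i <;> fin_cases j <;> simp [epsEnd_zero]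
  by_cases h4 : i = -2
  · subst h4
    rw [grading_neg_two, mem_component]
    refine ⟨Submodule.subset_span ⟨(2 : F)⁻¹ • (P.t : A), 1, ?_⟩,
      hcol (hx (by norm_num)) (hy (by norm_num))⟩
    rw [mat_toLieAlg, hs (by norm_num), ho (by norm_num), mulLeft_skew_eq_K P.t]
    ext i j z
    fin_cases i <;> fin_cases j <;> simp [epsEnd_zero]
  have hP0 : P = 0 := AllisonAlg.ext (hy h2) (ht h4) (ho h0) (hx h1) (hs h3)
  rw [hP0, toLieAlg_zero]
  exact zero_mem _

/-- The map `toLieAlg`, followed by the projection to matrices of operators, as a linear map. -/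
noncomputable def matHom (F A : Type*) [Field F] [NonAssocRing A] [StarRing A] [Module F A]
    [SMulCommClass F A A] [IsScalarTower F A A] [IsStructurable F A]
    [NeZero (2 : F)] [NeZero (3 : F)] :
    AllisonAlg F A →ₗ[F] Matrix (Fin 2) (Fin 2) (Module.End F A) where
  toFun P := (toLieAlg P).mat
  map_add' _ _ := by rw [toLieAlg_add, mat_add]
  map_smul' _ _ := by rw [toLieAlg_smul, mat_smul]; rfl

/-- The elements of `𝒦(A)` with vanishing components of degrees `-1` and `1`. -/
def evenPart (F A : Type*) [Field F] [NonAssocRing A] [StarRing A] [Module F A]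
    [SMulCommClass F A A] [IsScalarTower F A A] [IsStructurable F A] :
    Submodule F (AllisonAlg F A) where
  carrier := {P | P.x = 0 ∧ P.y = 0}
  add_mem' hP hQ := ⟨(congrArg₂ (· + ·) hP.1 hQ.1).trans (add_zero 0),
    (congrArg₂ (· + ·) hP.2 hQ.2).trans (add_zero 0)⟩
  zero_mem' := ⟨rfl, rfl⟩
  smul_mem' c _ hP := ⟨(congrArg (c • ·) hP.1).trans (smul_zero c),
    (congrArg (c • ·) hP.2).trans (smul_zero c)⟩

/-- The element of `𝒦(A)` with given components in degrees `-1`, `-2`, `0`, `1`, `2`. -/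
def ofComponents (y : A) (t : skewPart F A) (T : instrl F A) (x : A) (s : skewPart F A) :
    AllisonAlg F A := ((y, t), T, (x, s))

theorem matHom_ofComponents (y : A) (t : skewPart F A) (T : instrl F A) (x : A)
    (s : skewPart F A) : matHom F A (ofComponents y t T x s) =
    !![T.1, LinearMap.mulLeft F (s : A); LinearMap.mulLeft F (t : A), epsEnd T.1] := rfl

theorem mem_map_of_mem_span {S : Set (Matrix (Fin 2) (Fin 2) (Module.End F A))}
    {N : Submodule F (AllisonAlg F A)} (h : ∀ M ∈ S, ∃ P ∈ N, matHom F A P = M)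
    {M : Matrix (Fin 2) (Fin 2) (Module.End F A)} (hM : M ∈ Submodule.span F S) :
    ∃ P ∈ N, matHom F A P = M :=
  (Submodule.span_le.2 fun M hM => h M hM : Submodule.span F S ≤ N.map (matHom F A)) hM

theorem toLieAlg_eq {P : AllisonAlg F A} {Q : (Structurable.triple F A).LieAlg}
    (hm : matHom F A P = Q.mat) (hx : P.x = Q.col 0) (hy : P.y = Q.col 1) : toLieAlg P = Q := by
  refine LieAlg.ext _ hm ?_
  rw [col_toLieAlg]
  ext i
  fin_cases i <;> simp [hx, hy]

theorem exists_of_mem_grading {Q : (Structurable.triple F A).LieAlg} {i : ℤ}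
    (hQ : Q ∈ (Structurable.triple F A).grading i) :
    ∃ P ∈ AllisonAlg.grading F A i, toLieAlg P = Q := by
  by_cases h0 : i = 0
  · subst h0
    rw [grading_zero, mem_component, Submodule.mem_bot] at hQ
    obtain ⟨P, hP, hM⟩ := mem_map_of_mem_span (N := AllisonAlg.grading F A 0) (by
      rintro _ ⟨a, b, rfl⟩
      refine ⟨ofComponents 0 0 (innerV a b) 0 0, ?_, ?_⟩
      · exact ⟨fun _ => rfl, fun _ => rfl, fun h => absurd rfl h, fun _ => rfl, fun _ => rfl⟩
      · rw [matHom_ofComponents, L_triple, L_triple, ← epsEnd_opV]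
        ext i j z
        fin_cases i <;> fin_cases j <;> simp [innerV, op, s, t]) hQ.1
    refine ⟨P, hP, toLieAlg_eq hM ?_ ?_⟩
    · rw [hQ.2]; exact hP.2.2.2.1 (by norm_num)
    · rw [hQ.2]; exact hP.2.1 (by norm_num)
  by_cases h1 : i = 1
  · subst h1
    rw [grading_one, mem_component, Submodule.mem_bot] at hQ
    refine ⟨ofComponents 0 0 0 (Q.col 0) 0, ?_, toLieAlg_eq ?_ rfl hQ.2.symm⟩
    · exact ⟨fun _ => rfl, fun _ => rfl, fun _ => rfl, fun h => absurd rfl h, fun _ => rfl⟩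
    · rw [hQ.1, matHom_ofComponents]
      ext i j z
      fin_cases i <;> fin_cases j <;> simp [op, s, t, epsEnd_zero]
  by_cases h2 : i = -1
  · subst h2
    rw [grading_neg_one, mem_component, Submodule.mem_bot] at hQ
    refine ⟨ofComponents (Q.col 1) 0 0 0 0, ?_, toLieAlg_eq ?_ hQ.2.symm rfl⟩
    · exact ⟨fun _ => rfl, fun h => absurd rfl h, fun _ => rfl, fun _ => rfl, fun _ => rfl⟩
    · rw [hQ.1, matHom_ofComponents]
      ext i j z
      fin_cases i <;> fin_cases j <;> simp [op, s, t, epsEnd_zero]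
  by_cases h3 : i = 2
  · subst h3
    rw [grading_two, mem_component, Submodule.mem_bot] at hQ
    obtain ⟨P, hP, hM⟩ := mem_map_of_mem_span (N := AllisonAlg.grading F A 2) (by
      rintro _ ⟨a, b, rfl⟩
      refine ⟨ofComponents 0 0 0 0 (psi a b), ?_, ?_⟩
      · exact ⟨fun _ => rfl, fun _ => rfl, fun _ => rfl, fun _ => rfl, fun h => absurd rfl h⟩
      · rw [matHom_ofComponents, K_triple]
        ext i j z
        fin_cases i <;> fin_cases j <;> simp [op, s, t, epsEnd_zero]) hQ.1
    refine ⟨P, hP, toLieAlg_eq hM ?_ ?_⟩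
    · rw [hQ.2]; exact hP.2.2.2.1 (by norm_num)
    · rw [hQ.2]; exact hP.2.1 (by norm_num)
  by_cases h4 : i = -2
  · subst h4
    rw [grading_neg_two, mem_component, Submodule.mem_bot] at hQ
    obtain ⟨P, hP, hM⟩ := mem_map_of_mem_span (N := AllisonAlg.grading F A (-2)) (by
      rintro _ ⟨a, b, rfl⟩
      refine ⟨ofComponents 0 (psi a b) 0 0 0, ?_, ?_⟩
      · exact ⟨fun h => absurd rfl h, fun _ => rfl, fun _ => rfl, fun _ => rfl, fun _ => rfl⟩
      · rw [matHom_ofComponents, K_triple]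
        ext i j z
        fin_cases i <;> fin_cases j <;> simp [op, s, t, epsEnd_zero]) hQ.1
    refine ⟨P, hP, toLieAlg_eq hM ?_ ?_⟩
    · rw [hQ.2]; exact hP.2.2.2.1 (by norm_num)
    · rw [hQ.2]; exact hP.2.1 (by norm_num)
  rw [grading_eq_bot _ h0 h1 h2 h3 h4, Submodule.mem_bot] at hQ
  exact ⟨0, zero_mem _, by rw [toLieAlg_zero, hQ]⟩

theorem toLieAlg_surjective : Function.Surjective (toLieAlg (F := F) (A := A)) := by
  intro Q
  obtain ⟨P, hP, hM⟩ := mem_map_of_mem_span (N := evenPart F A) (by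
    rintro _ ⟨a, b, c, d, e, f, rfl⟩
    -- The lower diagonal entry -L(b,a) = -V_{b,a} equals V_{a,b}^ε, so each generating matrix is an
    -- image.
    refine ⟨ofComponents 0 (psi e f) (innerV a b) 0 (psi c d), ⟨rfl, rfl⟩, ?_⟩
    rw [matHom_ofComponents, genMatrix, K_triple, K_triple, L_triple, L_triple, ← epsEnd_opV]
    rfl) Q.1.2
  refine ⟨ofComponents (Q.col 1) P.t P.op (Q.col 0) P.s, toLieAlg_eq ?_ rfl rfl⟩
  exact hM

variable (F A) in
/-- `𝒦(A)` is isomorphic to the Lie algebra of the Kantor triple system `V_{x,y}(z)`. -/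
noncomputable def lieEquivLieAlg : AllisonAlg F A ≃ₗ⁅F⁆ (Structurable.triple F A).LieAlg :=
  LieEquiv.ofBijective
    { toFun := toLieAlg
      map_add' := toLieAlg_add
      map_smul' := toLieAlg_smul
      map_lie' := toLieAlg_lie _ _ }
    ⟨toLieAlg_injective, toLieAlg_surjective⟩

end AllisonAlg

/-! ### The 𝔰𝔩₂ of a left unit and its weight spaces. -/

namespace KantorTripleSystem

attribute [local instance] LieRing.ofAssociativeRing

section Weight

variable {F U : Type*} [Field F] [AddCommGroup U] [Module F U] (T : KantorTripleSystem F U)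

/-- The diagonal and off-diagonal parts of a matrix in the span are homogeneous. -/
theorem homogeneous_parts_mem {M : Matrix (Fin 2) (Fin 2) (Module.End F U)}
    (hM : M ∈ T.evenSpan) :
    !![M 0 0, 0; 0, M 1 1] ∈
        Submodule.span F {M | ∃ a b, M = !![T.L a b, 0; 0, -T.L b a]} ∧
      !![0, M 0 1; 0, 0] ∈ Submodule.span F {M | ∃ a b, M = !![0, T.K a b; 0, 0]} ∧
      !![0, 0; M 1 0, 0] ∈ Submodule.span F {M | ∃ a b, M = !![0, 0; T.K a b, 0]} := by
  induction hM using Submodule.span_induction with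
  | mem M h =>
    obtain ⟨a, b, c, d, e, f, rfl⟩ := h
    exact ⟨Submodule.subset_span ⟨a, b, rfl⟩, Submodule.subset_span ⟨c, d, rfl⟩,
      Submodule.subset_span ⟨e, f, rfl⟩⟩
  | zero =>
    refine ⟨?_, ?_, ?_⟩ <;> convert Submodule.zero_mem _ using 1 <;> ext i j : 2 <;>
      fin_cases i <;> fin_cases j <;> rfl
  | add M N _ _ hM hN =>
    refine ⟨?_, ?_, ?_⟩
    · convert add_mem hM.1 hN.1 using 1
      ext i j z; fin_cases i <;> fin_cases j <;> simp
    · convert add_mem hM.2.1 hN.2.1 using 1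
      ext i j z; fin_cases i <;> fin_cases j <;> simp
    · convert add_mem hM.2.2 hN.2.2 using 1
      ext i j z; fin_cases i <;> fin_cases j <;> simp
  | smul c M _ hM =>
    refine ⟨?_, ?_, ?_⟩
    · convert Submodule.smul_mem _ c hM.1 using 1
      ext i j z; fin_cases i <;> fin_cases j <;> simp
    · convert Submodule.smul_mem _ c hM.2.1 using 1
      ext i j z; fin_cases i <;> fin_cases j <;> simp
    · convert Submodule.smul_mem _ c hM.2.2 using 1
      ext i j z; fin_cases i <;> fin_cases j <;> simp

theorem span_diag_le : Submodule.span F {M | ∃ a b, M = !![T.L a b, 0; 0, -T.L b a]} ≤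
    T.evenSpan := by
  refine Submodule.span_le.2 ?_
  rintro _ ⟨a, b, rfl⟩
  refine Submodule.subset_span ⟨a, b, 0, 0, 0, 0, ?_⟩
  ext i j z; fin_cases i <;> fin_cases j <;> simp [genMatrix]

theorem span_upper_le : Submodule.span F {M | ∃ a b, M = !![0, T.K a b; 0, 0]} ≤
    T.evenSpan := by
  refine Submodule.span_le.2 ?_
  rintro _ ⟨a, b, rfl⟩
  refine Submodule.subset_span ⟨0, 0, a, b, 0, 0, ?_⟩
  ext i j z; fin_cases i <;> fin_cases j <;> simp [genMatrix]

theorem span_lower_le : Submodule.span F {M | ∃ a b, M = !![0, 0; T.K a b, 0]} ≤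
    T.evenSpan := by
  refine Submodule.span_le.2 ?_
  rintro _ ⟨a, b, rfl⟩
  refine Submodule.subset_span ⟨0, 0, 0, 0, a, b, ?_⟩
  ext i j z; fin_cases i <;> fin_cases j <;> simp [genMatrix]

/-- The element of `𝔤(U)` given by a column. -/
noncomputable def ofCol (X : Fin 2 → U) : T.LieAlg := (0, X)

theorem mat_ofCol (X : Fin 2 → U) : (T.ofCol X).mat = 0 := rfl
theorem col_ofCol (X : Fin 2 → U) : (T.ofCol X).col = X := rfl

/-- The element of `𝔤(U)` given by a matrix of operators. -/
noncomputable def ofMat (M : Matrix (Fin 2) (Fin 2) (Module.End F U)) (hM : M ∈ T.evenSpan) :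
    T.LieAlg := (⟨M, hM⟩, 0)

theorem mat_ofMat (M : Matrix (Fin 2) (Fin 2) (Module.End F U)) (hM : M ∈ T.evenSpan) :
    (T.ofMat M hM).mat = M := rfl
theorem col_ofMat (M : Matrix (Fin 2) (Fin 2) (Module.End F U)) (hM : M ∈ T.evenSpan) :
    (T.ofMat M hM).col = 0 := rfl

theorem ofCol_mem_grading_one (a : U) : T.ofCol ![a, 0] ∈ T.grading 1 := by
  rw [grading_one, mem_component, mat_ofCol, col_ofCol]
  exact ⟨zero_mem _, by simp⟩

theorem ofCol_mem_grading_neg_one (a : U) : T.ofCol ![0, a] ∈ T.grading (-1) := by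
  rw [grading_neg_one, mem_component, mat_ofCol, col_ofCol]
  exact ⟨zero_mem _, by simp⟩

theorem exists_mem_grading_add (P : T.LieAlg) : ∃ P₀ ∈ T.grading 0, ∃ P₁ ∈ T.grading 1,
    ∃ P₂ ∈ T.grading 2, ∃ Q₁ ∈ T.grading (-1), ∃ Q₂ ∈ T.grading (-2),
      P = P₀ + P₁ + P₂ + Q₁ + Q₂ := by
  obtain ⟨h0, h2, h3⟩ := T.homogeneous_parts_mem (M := P.mat) P.1.2
  refine ⟨T.ofMat _ (T.span_diag_le h0), ⟨h0, zero_mem _⟩, T.ofCol ![P.col 0, 0],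
    T.ofCol_mem_grading_one _, T.ofMat _ (T.span_upper_le h2), ⟨h2, zero_mem _⟩,
    T.ofCol ![0, P.col 1], T.ofCol_mem_grading_neg_one _, T.ofMat _ (T.span_lower_le h3),
    ⟨h3, zero_mem _⟩, ?_⟩
  ext i
  · simp only [mat_add, mat_ofMat, mat_ofCol]
    rename_i j z
    fin_cases i <;> fin_cases j <;> simp
  · simp only [col_add, col_ofMat, col_ofCol]
    fin_cases i <;> simp

variable {T}

theorem fin_two_zero : (!![0, 0; 0, 0] : Matrix (Fin 2) (Fin 2) (Module.End F U)) = 0 := by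
  ext i j z; fin_cases i <;> fin_cases j <;> rfl

/-- The element of `𝔤(U)` acting on columns as `diag(2,-2)`. -/
structure IsGradingElement (h : T.LieAlg) : Prop where
  mat : h.mat = !![(2 : F) • 1, 0; 0, -(2 : F) • 1]
  col : h.col = 0

namespace IsGradingElement

variable {h : T.LieAlg}

/-- The left sides are the two components of [h,P]: diag(2,-2) kills diagonal entries, multiplies
the off-diagonal ones by ±4 and the column entries by ±2. -/
theorem mem_weightSpace (hh : IsGradingElement h) {k : ℤ} {P : T.LieAlg} :
    P ∈ bc1WeightSpace F h k ↔
      (!![0, (4 : F) • P.mat 0 1; -(4 : F) • P.mat 1 0, 0] :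
        Matrix (Fin 2) (Fin 2) (Module.End F U)) = ((2 * k : ℤ) : F) • P.mat ∧
      ![(2 : F) • P.col 0, -(2 : F) • P.col 1] = ((2 * k : ℤ) : F) • P.col := by
  have hm : (⁅h, P⁆ : T.LieAlg).mat = !![0, (4 : F) • P.mat 0 1; -(4 : F) • P.mat 1 0, 0] := by
    rw [mat_lie, hh.mat, hh.col]
    ext i j z
    fin_cases i <;> fin_cases j <;>
      simp [Ring.lie_def, Matrix.mul_apply, Matrix.vecMul, dotProduct, colBracket] <;> module
  have hc : (⁅h, P⁆ : T.LieAlg).col = ![(2 : F) • P.col 0, -(2 : F) • P.col 1] := by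
    rw [col_lie, hh.mat, hh.col]
    ext i
    fin_cases i <;> simp [act]
  rw [bc1WeightSpace, Module.End.mem_eigenspace_iff, LieAlgebra.ad_apply, ← hm, ← hc,
    ← mat_smul, ← col_smul]
  exact ⟨fun h => ⟨congrArg _ h, congrArg _ h⟩, fun h => LieAlg.ext _ h.1 h.2⟩

theorem grading_le (hh : IsGradingElement h) {k : ℤ} :
    T.grading k ≤ bc1WeightSpace F h k := by
  intro P hP
  rw [hh.mem_weightSpace]
  by_cases h0 : k = 0
  · subst h0
    rw [grading_zero, mem_component, Submodule.mem_bot] at hP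
    have h1 : P.mat 0 1 = 0 ∧ P.mat 1 0 = 0 := by
      have : Submodule.span F {M | ∃ a b, M = !![T.L a b, 0; 0, -T.L b a]} ≤
          LinearMap.ker (Matrix.entryLinearMap F (Module.End F U) (0 : Fin 2) (1 : Fin 2)) ⊓
          LinearMap.ker (Matrix.entryLinearMap F (Module.End F U) (1 : Fin 2) (0 : Fin 2)) := by
        refine Submodule.span_le.2 ?_
        rintro _ ⟨a, b, rfl⟩
        simp
      exact this hP.1
    rw [hP.2, h1.1, h1.2]
    simp [fin_two_zero]
  by_cases h1 : k = 1
  · subst h1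
    rw [grading_one, mem_component, Submodule.mem_bot] at hP
    obtain ⟨hm, hc⟩ := hP
    simp at hc
    rw [hm, hc]
    constructor
    · simp [fin_two_zero]
    · ext i; fin_cases i <;> simp [hc]
  by_cases h2 : k = -1
  · subst h2
    rw [grading_neg_one, mem_component, Submodule.mem_bot] at hP
    obtain ⟨hm, hc⟩ := hP
    simp at hc
    rw [hm, hc]
    constructor
    · simp [fin_two_zero]
    · ext i; fin_cases i <;> simp [hc]
  by_cases h3 : k = 2
  · subst h3
    rw [grading_two, mem_component, Submodule.mem_bot] at hP
    refine ⟨?_, by rw [hP.2]; simp⟩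
    have : Submodule.span F {M | ∃ a b, M = !![0, T.K a b; 0, 0]} ≤
        LinearMap.ker (Matrix.entryLinearMap F (Module.End F U) (0 : Fin 2) (0 : Fin 2)) ⊓
        LinearMap.ker (Matrix.entryLinearMap F (Module.End F U) (1 : Fin 2) (0 : Fin 2)) ⊓
        LinearMap.ker (Matrix.entryLinearMap F (Module.End F U) (1 : Fin 2) (1 : Fin 2)) := by
      refine Submodule.span_le.2 ?_
      rintro _ ⟨a, b, rfl⟩
      simp
    obtain ⟨⟨e1, e2⟩, e3⟩ := this hP.1
    simp at e1 e2 e3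
    ext i j z
    fin_cases i <;> fin_cases j <;> norm_num [e1, e2, e3]
  by_cases h4 : k = -2
  · subst h4
    rw [grading_neg_two, mem_component, Submodule.mem_bot] at hP
    refine ⟨?_, by rw [hP.2]; simp⟩
    have : Submodule.span F {M | ∃ a b, M = !![0, 0; T.K a b, 0]} ≤
        LinearMap.ker (Matrix.entryLinearMap F (Module.End F U) (0 : Fin 2) (0 : Fin 2)) ⊓
        LinearMap.ker (Matrix.entryLinearMap F (Module.End F U) (0 : Fin 2) (1 : Fin 2)) ⊓
        LinearMap.ker (Matrix.entryLinearMap F (Module.End F U) (1 : Fin 2) (1 : Fin 2)) := by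
      refine Submodule.span_le.2 ?_
      rintro _ ⟨a, b, rfl⟩
      simp
    obtain ⟨⟨e1, e2⟩, e3⟩ := this hP.1
    simp at e1 e2 e3
    ext i j z
    fin_cases i <;> fin_cases j <;> norm_num [e1, e2, e3]
  rw [grading_eq_bot _ h0 h1 h2 h3 h4, Submodule.mem_bot] at hP
  rw [hP, mat_zero, col_zero]
  constructor
  · ext i j z; fin_cases i <;> fin_cases j <;> simp
  · ext i; fin_cases i <;> simp

theorem two_mul_cast_injective [NeZero (2 : F)] [NeZero (3 : F)] :
    Function.Injective fun k : Finset.Icc (-2 : ℤ) 2 => ((2 * k : ℤ) : F) := by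
  rintro ⟨a, ha⟩ ⟨b, hb⟩ hab
  rw [Finset.mem_Icc] at ha hb
  simp only [Int.cast_mul, Int.cast_ofNat] at hab
  have h1 : ((a - b : ℤ) : F) = 0 := by
    rw [Int.cast_sub, sub_eq_zero]
    exact mul_left_cancel₀ (NeZero.ne (2 : F)) hab
  by_contra hne
  have h2 : a - b ≠ 0 := fun h => hne (Subtype.ext (sub_eq_zero.mp h))
  -- Every nonzero integer between -4 and 4 divides 12 = 2·2·3, which is invertible in F.
  have h3 : a - b ∣ 12 := by
    have h4 : -4 ≤ a - b := by omega
    have h5 : a - b ≤ 4 := by omega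
    generalize a - b = d at h2 h4 h5
    interval_cases d <;> first | exact absurd rfl h2 | norm_num
  obtain ⟨c, hc⟩ := h3
  have h6 : (2 * 2 * 3 : F) = 0 := by
    have := congrArg (Int.cast : ℤ → F) hc
    rw [Int.cast_mul, h1, zero_mul] at this
    rw [← this]; norm_num
  exact mul_ne_zero (mul_ne_zero (NeZero.ne 2) (NeZero.ne 2)) (NeZero.ne 3) h6

/-- Eigenspaces for distinct eigenvalues are independent. They span because each contains the
homogeneous component of its degree and these components span 𝔤(U). -/
theorem isInternal (hh : IsGradingElement h) [NeZero (2 : F)] [NeZero (3 : F)] :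
    DirectSum.IsInternal (fun k : Finset.Icc (-2 : ℤ) 2 => bc1WeightSpace F h k) := by
  refine DirectSum.isInternal_submodule_of_iSupIndep_of_iSup_eq_top ?_ ?_
  · exact (Module.End.eigenspaces_iSupIndep (LieAlgebra.ad F T.LieAlg h)).comp
      two_mul_cast_injective
  · rw [eq_top_iff]
    intro P _
    have key : ∀ k ∈ Finset.Icc (-2 : ℤ) 2, ∀ Q ∈ T.grading k,
        Q ∈ ⨆ k : Finset.Icc (-2 : ℤ) 2, bc1WeightSpace F h k := fun k hk Q hQ =>
      Submodule.mem_iSup_of_mem (p := fun k : Finset.Icc (-2 : ℤ) 2 => bc1WeightSpace F h k)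
        ⟨k, hk⟩ (hh.grading_le hQ)
    obtain ⟨P₀, h0, P₁, h1, P₂, h2, Q₁, h3, Q₂, h4, rfl⟩ := T.exists_mem_grading_add P
    exact add_mem (add_mem (add_mem (add_mem (key 0 (by simp) _ h0) (key 1 (by simp) _ h1))
      (key 2 (by simp) _ h2)) (key (-1) (by simp) _ h3)) (key (-2) (by simp) _ h4)

theorem weightSpace_zero (hh : IsGradingElement h) [NeZero (2 : F)] :
    bc1WeightSpace F h 0 = Submodule.span F
      {z | ∃ k ∈ Finset.Icc (-2 : ℤ) 2, k ≠ 0 ∧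
        ∃ a ∈ bc1WeightSpace F h k, ∃ b ∈ bc1WeightSpace F h (-k), z = ⁅a, b⁆} := by
  refine le_antisymm ?_ (Submodule.span_le.2 ?_)
  · intro P hP
    rw [hh.mem_weightSpace] at hP
    obtain ⟨hm, hc⟩ := hP
    simp only [mul_zero, Int.cast_zero, zero_smul] at hm hc
    have h4 : (4 : F) ≠ 0 := by
      rw [show (4 : F) = 2 * 2 by norm_num]; exact mul_ne_zero (NeZero.ne 2) (NeZero.ne 2)
    have e1 : P.mat 0 1 = 0 := by
      have := congrFun (congrFun hm 0) 1
      simpa [h4] using this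
    have e2 : P.mat 1 0 = 0 := by
      have := congrFun (congrFun hm 1) 0
      simpa [h4] using this
    have e3 : P.col 0 = 0 := by
      have := congrFun hc 0
      simpa [NeZero.ne (2 : F)] using this
    have e4 : P.col 1 = 0 := by
      have := congrFun hc 1
      simpa [NeZero.ne (2 : F)] using this
    have hdiag := (T.homogeneous_parts_mem (M := P.mat) P.1.2).1
    have key : ∀ M ∈ Submodule.span F {M | ∃ a b, M = !![T.L a b, 0; 0, -T.L b a]},
        ∃ Q ∈ Submodule.span F {z | ∃ k ∈ Finset.Icc (-2 : ℤ) 2, k ≠ 0 ∧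
          ∃ a ∈ bc1WeightSpace F h k, ∃ b ∈ bc1WeightSpace F h (-k), z = ⁅a, b⁆},
          Q.mat = M ∧ Q.col = 0 := by
      intro M hM
      induction hM using Submodule.span_induction with
      | mem M h =>
        obtain ⟨a, b, rfl⟩ := h
        -- Brackets of degrees 1 and -1 already yield every generator of degree 0.
        refine ⟨⁅T.ofCol ![a, 0], T.ofCol ![0, b]⁆, Submodule.subset_span ⟨1, by simp, by simp,
          _, hh.grading_le (T.ofCol_mem_grading_one a), _,
          hh.grading_le (T.ofCol_mem_grading_neg_one b), rfl⟩, ?_, ?_⟩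
        · rw [mat_lie, mat_ofCol, mat_ofCol, col_ofCol, col_ofCol, lie_zero, zero_add]
          ext i j z
          fin_cases i <;> fin_cases j <;> simp [colBracket]
        · rw [col_lie, mat_ofCol, mat_ofCol, zero_act, zero_act, sub_zero]
      | zero => exact ⟨0, zero_mem _, rfl, rfl⟩
      | add M N _ _ hM hN =>
        obtain ⟨Q, hQ, hQm, hQc⟩ := hM
        obtain ⟨R, hR, hRm, hRc⟩ := hN
        exact ⟨Q + R, add_mem hQ hR, by rw [mat_add, hQm, hRm],
          by rw [col_add, hQc, hRc, add_zero]⟩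
      | smul c M _ hM =>
        obtain ⟨Q, hQ, hQm, hQc⟩ := hM
        exact ⟨c • Q, Submodule.smul_mem _ c hQ, by rw [mat_smul, hQm],
          by rw [col_smul, hQc, smul_zero]⟩
    obtain ⟨Q, hQ, hQm, hQc⟩ := key _ hdiag
    have hPQ : P = Q := by
      ext i
      · rename_i j z
        rw [hQm]
        fin_cases i <;> fin_cases j <;> simp [e1, e2]
      · rw [hQc]
        fin_cases i <;> simp [e3, e4]
    rw [hPQ]
    exact hQ
  · rintro _ ⟨k, -, -, a, ha, b, hb, rfl⟩
    simp only [bc1WeightSpace, SetLike.mem_coe, Module.End.mem_eigenspace_iff,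
      LieAlgebra.ad_apply] at ha hb ⊢
    rw [leibniz_lie, ha, hb, smul_lie, lie_smul, ← add_smul]
    push_cast
    ring_nf

end IsGradingElement

/-- The map from `𝔰𝔩₂` given by a left unit. -/
noncomputable def slMap (T : KantorTripleSystem F U) (e : U)
    (M : LieAlgebra.SpecialLinear.sl (Fin 2) F) : T.LieAlg :=
  -- The bracket of (e,0) and (0,e) is only diag(id,-id). The factors 2 make diag(1,-1) act on
  -- columns as diag(2,-2), so that α(h) = 2.
  (T.colLie ![((2 : F) * M.1 0 0) • e, 0] ![0, e], ![M.1 0 1 • e, ((2 : F) * M.1 1 0) • e])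

theorem IsLeftUnit.mat_slMap {e : U} (he : T.IsLeftUnit e)
    (M : LieAlgebra.SpecialLinear.sl (Fin 2) F) :
    (T.slMap e M).mat = !![((2 : F) * M.1 0 0) • 1, 0; 0, -((2 : F) * M.1 0 0) • 1] := by
  change T.colBracket _ _ = _
  ext i j z
  fin_cases i <;> fin_cases j <;> simp [colBracket, he.unit_apply]

theorem col_slMap (e : U) (M : LieAlgebra.SpecialLinear.sl (Fin 2) F) :
    (T.slMap e M).col = ![M.1 0 1 • e, ((2 : F) * M.1 1 0) • e] := rfl

theorem sl_apply_one_one (M : LieAlgebra.SpecialLinear.sl (Fin 2) F) : M.1 1 1 = -M.1 0 0 := by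
  have h : Matrix.trace M.1 = 0 := M.2
  rw [Matrix.trace_fin_two] at h
  linear_combination h

/-- The homomorphism from `𝔰𝔩₂` given by a left unit. -/
noncomputable def slHom {e : U} (he : T.IsLeftUnit e) :
    LieAlgebra.SpecialLinear.sl (Fin 2) F →ₗ⁅F⁆ T.LieAlg where
  toFun := T.slMap e
  map_add' M N := by
    refine LieAlg.ext _ ?_ ?_
    · rw [mat_add, he.mat_slMap, he.mat_slMap, he.mat_slMap]
      ext i j z
      fin_cases i <;> fin_cases j <;> simp <;> module
    · rw [col_add, col_slMap, col_slMap, col_slMap]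
      ext i
      fin_cases i <;> simp <;> module
  map_smul' c M := by
    refine LieAlg.ext _ ?_ ?_
    · rw [mat_smul, he.mat_slMap, he.mat_slMap]
      ext i j z
      fin_cases i <;> fin_cases j <;> simp <;> module
    · rw [col_smul, col_slMap, col_slMap]
      ext i
      fin_cases i <;> simp <;> module
  map_lie' {M N} := by
    have hMN : (⁅M, N⁆ : LieAlgebra.SpecialLinear.sl (Fin 2) F).1 = M.1 * N.1 - N.1 * M.1 := rfl
    have hM := sl_apply_one_one M
    have hN := sl_apply_one_one N
    refine LieAlg.ext _ ?_ ?_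
    · rw [mat_lie, he.mat_slMap, he.mat_slMap, he.mat_slMap, col_slMap, col_slMap, hMN]
      ext i j z
      fin_cases i <;> fin_cases j <;>
        simp [colBracket, Ring.lie_def, Matrix.mul_apply, he.unit_apply] <;> module
    · rw [col_lie, he.mat_slMap, he.mat_slMap, col_slMap, col_slMap, col_slMap, hMN]
      ext i
      fin_cases i <;> simp [act, Matrix.mul_apply, hM, hN] <;> module

theorem slHom_apply {e : U} (he : T.IsLeftUnit e) (M : LieAlgebra.SpecialLinear.sl (Fin 2) F) :
    slHom he M = T.slMap e M := rfl

theorem slHom_injective [NeZero (2 : F)] [Nontrivial U] {e : U} (he : T.IsLeftUnit e) :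
    Function.Injective (slHom he) := by
  have h0 : e ≠ 0 := by
    rintro rfl
    obtain ⟨z, hz⟩ := exists_ne (0 : U)
    exact hz (by rw [← he.unit_apply z, map_zero, LinearMap.zero_apply])
  rw [injective_iff_map_eq_zero]
  intro M hM
  rw [slHom_apply] at hM
  have hm := he.mat_slMap M
  have hc := col_slMap (T := T) e M
  rw [hM, mat_zero] at hm
  rw [hM, col_zero] at hc
  have h1 : M.1 0 0 = 0 := by
    have := LinearMap.congr_fun (congrFun (congrFun hm 0) 0) e
    simpa [h0, NeZero.ne (2 : F)] using this.symm
  have h2 : M.1 0 1 = 0 := by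
    have := congrFun hc 0
    simpa [h0] using this.symm
  have h3 : M.1 1 0 = 0 := by
    have := congrFun hc 1
    simpa [h0, NeZero.ne (2 : F)] using this.symm
  have h4 := sl_apply_one_one M
  rw [h1, neg_zero] at h4
  refine Subtype.ext ?_
  ext i j
  fin_cases i <;> fin_cases j <;> simp [h1, h2, h3, h4]

theorem isBC1GradedOfTypeB1 [NeZero (2 : F)] [NeZero (3 : F)] [Nontrivial U] {e : U}
    (he : T.IsLeftUnit e) : IsBC1GradedOfTypeB1 F T.LieAlg := by
  have hh : IsGradingElement
      (slHom he (LieAlgebra.SpecialLinear.singleSubSingle 0 1 1)) := by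
    constructor
    · rw [slHom_apply, he.mat_slMap, LieAlgebra.SpecialLinear.val_singleSubSingle]
      simp
    · rw [slHom_apply, col_slMap, LieAlgebra.SpecialLinear.val_singleSubSingle]
      ext i
      fin_cases i <;> simp
  exact ⟨slHom he, _, slHom_injective he, rfl, hh.isInternal, hh.weightSpace_zero⟩

end Weight

/-! ### The graded isomorphism from 𝔤(U) to 𝒦(A). -/

section Untwist

variable {F U : Type*} [Field F] [AddCommGroup U] [Module F U] {T : KantorTripleSystem F U}
  [NeZero (2 : F)] [NeZero (3 : F)] {e : U}

theorem isNormalizedUnit_untwist (he : T.IsLeftUnit e) : (untwist he).IsNormalizedUnit e where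
  isLeftUnit := isLeftUnit_untwist he
  conj := untwist_conj he

/-- The algebra of a Kantor triple system with a left unit. -/
abbrev StructurableAlg (he : T.IsLeftUnit e) : Type _ :=
  UnitalAlg (isNormalizedUnit_untwist he)

/-- `τ` as a linear equivalence. -/
noncomputable def twistEquiv (he : T.IsLeftUnit e) : U ≃ₗ[F] U :=
  LinearEquiv.ofInvolutive (T.twist e) he.twist_twist

/-- The pair is (id, τ). The first condition is τ² = 1, since the product of the algebra is x(τy)z,
and the second is that τ is an automorphism. -/
theorem isPairEquiv_triple (he : T.IsLeftUnit e) :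
    IsPairEquiv T (Structurable.triple F (StructurableAlg he))
      (UnitalAlg.of (isNormalizedUnit_untwist he))
      ((twistEquiv he).trans (UnitalAlg.of (isNormalizedUnit_untwist he))) where
  left x y z := by
    refine Eq.trans ?_ (UnitalAlg.triple_apply (he := isNormalizedUnit_untwist he) _ _ _).symm
    change T.triple x y z = T.triple x (T.twist e (T.twist e y)) z
    rw [he.twist_twist]
  right x y z := by
    refine Eq.trans ?_ (UnitalAlg.triple_apply (he := isNormalizedUnit_untwist he) _ _ _).symm
    exact he.twist_triple x y z

/-- The isomorphism from `𝔤(U)` to Allison's algebra. -/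
noncomputable def lieEquivAllison (he : T.IsLeftUnit e) :
    T.LieAlg ≃ₗ⁅F⁆ AllisonAlg F (StructurableAlg he) :=
  (isPairEquiv_triple he).lieEquiv.trans
    (AllisonAlg.lieEquivLieAlg F (StructurableAlg he)).symm

theorem map_grading_lieEquivAllison (he : T.IsLeftUnit e) (i : ℤ) :
    (T.grading i).map (lieEquivAllison he : T.LieAlg →ₗ[F] AllisonAlg F (StructurableAlg he)) =
      AllisonAlg.grading F (StructurableAlg he) i := by
  let g := AllisonAlg.lieEquivLieAlg F (StructurableAlg he)
  apply le_antisymm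
  · rintro _ ⟨P, hP, rfl⟩
    obtain ⟨Q, hQ, hQP⟩ := AllisonAlg.exists_of_mem_grading
      ((isPairEquiv_triple he).lieHom_mem_grading hP)
    have : lieEquivAllison he P = Q := by
      change g.symm ((isPairEquiv_triple he).lieHom P) = Q
      rw [← hQP]
      exact g.symm_apply_apply Q
    change lieEquivAllison he P ∈ _
    rwa [this]
  · intro Q hQ
    refine ⟨(isPairEquiv_triple he).symm.lieHom (AllisonAlg.toLieAlg Q),
      (isPairEquiv_triple he).symm.lieHom_mem_grading (AllisonAlg.toLieAlg_mem_grading hQ), ?_⟩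
    change g.symm ((isPairEquiv_triple he).lieEquiv
      ((isPairEquiv_triple he).lieEquiv.symm (g Q))) = Q
    rw [LieEquiv.apply_symm_apply, LieEquiv.symm_apply_apply]

end Untwist

end KantorTripleSystem

theorem corollary4p2 {F : Type v} [Field F] [NeZero (2 : F)] [NeZero (3 : F)]
    {U : Type u} [AddCommGroup U] [Module F U] (T : KantorTripleSystem F U)
    (hT : T.IsLeftUnital) :
    (∃ (A : Type u) (_ : NonAssocRing A) (_ : StarRing A) (_ : Module F A)
        (_ : SMulCommClass F A A) (_ : IsScalarTower F A A) (_ : IsStructurable F A)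
        (f : T.LieAlg ≃ₗ⁅F⁆ AllisonAlg F A),
        ∀ i : ℤ, (T.grading i).map (f : T.LieAlg →ₗ[F] AllisonAlg F A) =
          AllisonAlg.grading F A i) ∧
      (Nontrivial U → IsBC1GradedOfTypeB1 F T.LieAlg) := by
  obtain ⟨e, he⟩ := hT
  refine ⟨⟨KantorTripleSystem.StructurableAlg he, inferInstance, inferInstance, inferInstance,
    inferInstance, inferInstance, inferInstance, KantorTripleSystem.lieEquivAllison he,
    KantorTripleSystem.map_grading_lieEquivAllison he⟩, fun _ => ?_⟩
  exact KantorTripleSystem.isBC1GradedOfTypeB1 he
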